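/- Let $\alpha=\{\alpha_k\}_{k\in\mathbb Z}\subset\mathbb D$, where $\mathbb D$ is the open unit disk, and put $\rho_k=(1-|\alpha_k|^2)^{1/2}$ and $\Theta_k=\begin{pmatrix}-\alpha_k&\rho_k\\ \rho_k&\overline{\alpha_k}\end{pmatrix}$. Let $V$ (resp. $W$) be the operator on $\ell^2(\mathbb Z)$ that is block diagonal with the blocks $\Theta_{2k}$ on the coordinates $(2k-1,2k)$ (resp. $\Theta_{2k+1}$ on the coordinates $(2k,2k+1)$), $k\in\mathbb Z$, and let $U=VW$ be the CMV operator. Let $t\in[0,2\pi)$, $k_0\in\mathbb Z$, $\gamma=e^{-it/2}$. If $\alpha_{k_0}$ is replaced by $e^{it}$, $U$ splits into a direct sum over $\ell^2((-\infty,k_0-1]\cap\mathbb Z)\oplus\ell^2([k_0,\infty)\cap\mathbb Z)$; its component on $\ell^2([k_0,\infty)\cap\mathbb Z)$ is denoted by $U^{(t)}_{+,k_0}$. Likewise $U^{(t)}_{-,k_0}$ is the component on $\ell^2((-\infty,k_0]\cap\mathbb Z)$ when $\alpha_{k_0+1}$ is replaced by $e^{it}$. For $z\neq0$ let $$T(z,k)=\frac1{\rho_k}\begin{pmatrix}\alpha_k&z\\1/z&\overline{\alpha_k}\end{pmatrix}\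 (k\text{ odd}),\qquad T(z,k)=\frac1{\rho_k}\begin{pmatrix}\overline{\alpha_k}&1\\1&\alpha_k\end{pmatrix}\ (k\text{ even}),$$ and let $\binom{p_\pm}{r_\pm}(z,\cdot,k_0)$, $\binom{q_\pm}{s_\pm}(z,\cdot,k_0)$ (all depending on $t$) be the solutions of $Y(k)=T(z,k)Y(k-1)$, $k\in\mathbb Z$, with the values at $k=k_0$ $$\binom{p_+}{r_+}=\binom{z\overline\gamma}{\gamma},\ \binom{q_+}{s_+}=\binom{z\overline\gamma}{-\gamma},\ \binom{p_-}{r_-}=\binom{\overline\gamma}{-\gamma},\ \binom{q_-}{s_-}=\binom{\overline\gamma}{\gamma}\quad(k_0\text{ odd}),$$ $$\binom{p_+}{r_+}=\binom{\gamma}{\overline\gamma},\ \binom{q_+}{s_+}=\binom{-\gamma}{\overline\gamma},\ \binom{p_-}{r_-}=\binom{-z\gamma}{\overline\gamma},\ \binom{q_-}{s_-}=\binom{z\gamma}{\overline\gamma}\quad(k_0\text{ even}).$$ For $|z|\ne1$ let $m_\pm(z,k_0)=\pm\big(\delta_{k_0},(U^{(t)}_{\pm,k_0}+zI)(U^{(t)}_{\pm,k_0}-zI)^{-1}\delta_{k_0}\big)$,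 and for $z\in\mathbb C\setminus(\partial\mathbb D\cup\{0\})$ let $\binom{\widehat u_\pm}{\widehat v_\pm}=\binom{q_\pm}{s_\pm}+m_\pm\binom{p_\pm}{r_\pm}$. Write $A(k,k')=(\delta_k,A\delta_{k'})$ for matrix entries in the standard basis, and $(n \bmod 2)\in\{0,1\}$. In every two-line case distinction below the first line is for $k<k'$ and for $k=k'$ odd, the second for $k>k'$ and for $k=k'$ even. Then $U$ and $U^{(t)}_{\pm,k_0}$ are unitary, every $z$ with $|z|\neq1$ is in their resolvent sets, $\widehat u_\pm(z,\cdot,k_0),\widehat v_\pm(z,\cdot,k_0)\in\ell^2([k_0,\pm\infty)\cap\mathbb Z)$, and for all $z\in\mathbb C\setminus(\partial\mathbb D\cup\{0\})$: for $k,k'\ge k_0$, $$(U^{(t)}_{+,k_0}-zI)^{-1}(k,k')=\frac{z^{-(k_0\bmod 2)}}{2z}\begin{cases}p_+(z,k,k_0)\,\widehat v_+(z,k',k_0)\\ \widehat u_+(z,k,k_0)\,r_+(z,k',k_0)\end{cases}=\frac1{2z}\begin{cases}-p_+(z,k,k_0)\,\overline{\widehat u_+(1/\overline z,k',k_0)}\\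 \widehat u_+(z,k,k_0)\,\overline{p_+(1/\overline z,k',k_0)}\end{cases}$$ for $k,k'\le k_0$, $$(U^{(t)}_{-,k_0}-zI)^{-1}(k,k')=\frac{z^{-((k_0+1)\bmod 2)}}{2z}\begin{cases}\widehat u_-(z,k,k_0)\,r_-(z,k',k_0)\\ p_-(z,k,k_0)\,\widehat v_-(z,k',k_0)\end{cases}=\frac1{2z}\begin{cases}-\widehat u_-(z,k,k_0)\,\overline{p_-(1/\overline z,k',k_0)}\\ p_-(z,k,k_0)\,\overline{\widehat u_-(1/\overline z,k',k_0)}\end{cases}$$ Moreover, there are a unique Caratheodory function $M_+(\cdot,k_0)$ and a unique anti-Caratheodory function $M_-(\cdot,k_0)$ (analytic in $\mathbb D$ with real part $\geq0$, resp. $\le0$, there, and extended to $|z|>1$ by $M_\pm(z)=-\overline{M_\pm(1/\overline z)}$) such that $\binom{u_\pm}{v_\pm}=\binom{q_+}{s_+}+M_\pm\binom{p_+}{r_+}\in\ell^2([k_0,\pm\infty)\cap\mathbb Z)^2$ for all $z\in\mathbb C\setminus(\partial\mathbb D\cup\{0\})$. They satisfy $M_+(z,k_0)\ne M_-(z,k_0)$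 for $|z|\neq1$, and for $k,k'\in\mathbb Z$ and $z\in\mathbb C\setminus(\partial\mathbb D\cup\{0\})$, $$(U-zI)^{-1}(k,k')=\frac{-z^{-(k_0\bmod 2)}}{2z[M_+(z,k_0)-M_-(z,k_0)]}\begin{cases}u_-(z,k,k_0)\,v_+(z,k',k_0)\\ u_+(z,k,k_0)\,v_-(z,k',k_0)\end{cases}$$ $$=\frac1{2z[M_+(z,k_0)-M_-(z,k_0)]}\begin{cases}u_-(z,k,k_0)\,\overline{u_+(1/\overline z,k',k_0)}\\ u_+(z,k,k_0)\,\overline{u_-(1/\overline z,k',k_0)}\end{cases}$$ Finally, each of the six right-hand sides, as a function of $z$, extends analytically to $z=0$, with the value $(U^{(t)}_{\pm,k_0})^{-1}(k,k')$, resp. $U^{-1}(k,k')$, there. -/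

import Mathlib

noncomputable section

namespace CMV

open scoped lp Matrix ComplexConjugate InnerProductSpace

/-! ### Auxiliary bounded operators on `ℓ²` -/

/-- Pull-back of square summable sequences along an injection: `f ↦ f ∘ σ`. -/
def pullback {ι κ : Type} (σ : κ ↪ ι) : ℓ²(ι, ℂ) →L[ℂ] ℓ²(κ, ℂ) :=
  LinearMap.mkContinuous
    { toFun := fun f => ⟨fun k => f (σ k), by
        have h := (memℓp_gen_iff (p := 2) (by norm_num)).1 (lp.memℓp f)
        exact (memℓp_gen_iff (p := 2) (by norm_num)).2 (h.comp_injective σ.injective)⟩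
      map_add' := fun _ _ => by ext; rfl
      map_smul' := fun _ _ => by ext; rfl }
    1 (fun f => by
      rw [one_mul]
      refine lp.norm_le_of_tsum_le (by norm_num) (norm_nonneg _) ?_
      rw [lp.norm_rpow_eq_tsum (p := 2) (by norm_num) f]
      have h := (memℓp_gen_iff (p := 2) (by norm_num)).1 (lp.memℓp f)
      exact (h.comp_injective σ.injective).tsum_le_tsum_of_inj σ σ.injective
        (fun c _ => by positivity) (fun i => le_rfl) h)

theorem pullback_apply {ι κ : Type} (σ : κ ↪ ι) (f : ℓ²(ι, ℂ)) (k : κ) :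
    pullback σ f k = f (σ k) := rfl

/-- The shift `(S f)(k) = f (k + n)` on `ℓ²(ℤ)`. -/
def shift (n : ℤ) : ℓ²(ℤ, ℂ) →L[ℂ] ℓ²(ℤ, ℂ) := pullback (addRightEmbedding n)

theorem shift_apply (n : ℤ) (f : ℓ²(ℤ, ℂ)) (k : ℤ) : shift n f k = f (k + n) := rfl

/-- Multiplication by a sequence bounded by one: `f ↦ c f`. -/
def diagonal (c : ℤ → ℂ) (hc : ∀ k, ‖c k‖ ≤ 1) : ℓ²(ℤ, ℂ) →L[ℂ] ℓ²(ℤ, ℂ) :=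
  lp.mapCLM 2 (fun k => c k • ContinuousLinearMap.id ℂ ℂ) zero_le_one (fun k => by
    simpa [norm_smul] using hc k)

theorem diagonal_apply (c : ℤ → ℂ) (hc : ∀ k, ‖c k‖ ≤ 1) (f : ℓ²(ℤ, ℂ)) (k : ℤ) :
    diagonal c hc f k = c k * f k := by
  simp [diagonal, lp.mapCLM_apply_coe]

/-! ### CMV operators -/

/-- `ρ_k = (1 - |α_k|²)^{1/2}`. -/
def rho (α : ℤ → ℂ) (k : ℤ) : ℝ := Real.sqrt (1 - ‖α k‖ ^ 2)

theorem rho_norm_le (α : ℤ → ℂ) (k : ℤ) : ‖(rho α k : ℂ)‖ ≤ 1 := by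
  rw [Complex.norm_real, rho, Real.norm_of_nonneg (Real.sqrt_nonneg _), Real.sqrt_le_one]
  nlinarith [sq_nonneg ‖α k‖]

open Classical in
/-- The block diagonal operator on `ℓ²(ℤ)` with the blocks
`Θ_k = ((-α_k, ρ_k), (ρ_k, conj α_k))` on the coordinates `(k - 1, k)`, for all `k` with `P k`
(here `P` is `Even` or `Odd`). If `P k`, row `k` is the second row of `Θ_k`;
otherwise `P (k + 1)`, and row `k` is the first row of `Θ_{k+1}`. -/
def thetaOp (P : ℤ → Prop) (α : ℤ → ℂ) (hα : ∀ k, ‖α k‖ ≤ 1) : ℓ²(ℤ, ℂ) →L[ℂ] ℓ²(ℤ, ℂ) :=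
  diagonal (fun k => if P k then conj (α k) else -α (k + 1))
      (fun k => by split_ifs <;> simpa using hα _)
    + diagonal (fun k => if P k then (rho α k : ℂ) else 0)
      (fun k => by split_ifs <;> [exact rho_norm_le α k; simp]) ∘L shift (-1)
    + diagonal (fun k => if P k then 0 else (rho α (k + 1) : ℂ))
      (fun k => by split_ifs <;> [simp; exact rho_norm_le α (k + 1)]) ∘L shift 1

open Classical in
theorem thetaOp_apply (P : ℤ → Prop) (α : ℤ → ℂ) (hα : ∀ k, ‖α k‖ ≤ 1) (f : ℓ²(ℤ, ℂ)) (k : ℤ) :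
    thetaOp P α hα f k =
      if P k then rho α k * f (k - 1) + conj (α k) * f k
      else -α (k + 1) * f k + rho α (k + 1) * f (k + 1) := by
  simp only [thetaOp, add_apply, ContinuousLinearMap.comp_apply,
    lp.coeFn_add, Pi.add_apply, diagonal_apply, shift_apply]
  split_ifs
  · rw [← sub_eq_add_neg]; ring
  · ring

/-- `V`, with the blocks `Θ_{2k}` on the coordinates `(2k - 1, 2k)`. -/
def opV (α : ℤ → ℂ) (hα : ∀ k, ‖α k‖ ≤ 1) : ℓ²(ℤ, ℂ) →L[ℂ] ℓ²(ℤ, ℂ) := thetaOp Even α hα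

/-- `W`, with the blocks `Θ_{2k+1}` on the coordinates `(2k, 2k + 1)`. -/
def opW (α : ℤ → ℂ) (hα : ∀ k, ‖α k‖ ≤ 1) : ℓ²(ℤ, ℂ) →L[ℂ] ℓ²(ℤ, ℂ) := thetaOp Odd α hα

/-- The full-lattice CMV operator `U = V W`. One of the coefficients is allowed to be unimodular;
then `U` decouples. -/
def opU (α : ℤ → ℂ) (hα : ∀ k, ‖α k‖ ≤ 1) : ℓ²(ℤ, ℂ) →L[ℂ] ℓ²(ℤ, ℂ) :=
  opV α hα ∘L opW α hα

/-- Restriction of square summable sequences on `ℤ` to `S ⊆ ℤ`. -/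
def restrict (S : Set ℤ) : ℓ²(ℤ, ℂ) →L[ℂ] ℓ²(S, ℂ) := pullback (Function.Embedding.subtype (· ∈ S))

/-- Extension by zero of square summable sequences on `S ⊆ ℤ` (the adjoint of restriction). -/
def extend (S : Set ℤ) : ℓ²(S, ℂ) →L[ℂ] ℓ²(ℤ, ℂ) := ContinuousLinearMap.adjoint (restrict S)

open Classical in
theorem extend_apply (S : Set ℤ) (f : ℓ²(S, ℂ)) (k : ℤ) :
    extend S f k = if h : k ∈ S then f ⟨k, h⟩ else 0 := by
  have h1 : inner ℂ (lp.single 2 k (1 : ℂ)) (extend S f) = extend S f k := by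
    simp [lp.inner_single_left]
  rw [← h1, extend, ContinuousLinearMap.adjoint_inner_right]
  split_ifs with h
  · have : restrict S (lp.single 2 k (1 : ℂ)) = lp.single 2 (⟨k, h⟩ : S) (1 : ℂ) := by
      ext j
      rw [restrict, pullback_apply]
      by_cases hj : (j : ℤ) = k
      · obtain rfl : j = ⟨k, h⟩ := Subtype.ext hj
        simp
      · have hj' : j ≠ ⟨k, h⟩ := fun e => hj (congrArg Subtype.val e)
        rw [lp.single_apply_ne 2 _ _ hj']
        exact lp.single_apply_ne 2 _ _ hj
    rw [this]
    simp [lp.inner_single_left]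
  · have : restrict S (lp.single 2 k (1 : ℂ)) = 0 := by
      ext j
      rw [restrict, pullback_apply]
      have hj : (j : ℤ) ≠ k := fun e => h (e ▸ j.2)
      exact lp.single_apply_ne 2 _ _ hj
    rw [this, inner_zero_left]

/-- The coefficients `α` with `α_n` replaced by `e^{it}`. -/
def setCoeff (α : ℤ → ℂ) (n : ℤ) (t : ℝ) : ℤ → ℂ :=
  Function.update α n (Complex.exp (Complex.I * t))

theorem setCoeff_norm_le {α : ℤ → ℂ} (hα : ∀ k, ‖α k‖ ≤ 1) (n : ℤ) (t : ℝ) (k : ℤ) :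
    ‖setCoeff α n t k‖ ≤ 1 := by
  by_cases h : k = n
  · subst h
    simp [setCoeff, mul_comm Complex.I, Complex.norm_exp_ofReal_mul_I]
  · simpa [setCoeff, h] using hα k

/-- The half-lattice operator `U^{(t)}_{+,k₀}` on `ℓ²([k₀,∞) ∩ ℤ)`: the corresponding component of
the full-lattice operator with `α_{k₀} = e^{it}`, which decouples between `k₀ - 1` and `k₀`. -/
def opUPlus (α : ℤ → ℂ) (hα : ∀ k, ‖α k‖ ≤ 1) (t : ℝ) (k₀ : ℤ) :
    ℓ²(Set.Ici k₀, ℂ) →L[ℂ] ℓ²(Set.Ici k₀, ℂ) :=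
  restrict (Set.Ici k₀) ∘L opU (setCoeff α k₀ t) (setCoeff_norm_le hα k₀ t) ∘L
    extend (Set.Ici k₀)

/-- The half-lattice operator `U^{(t)}_{-,k₀}` on `ℓ²((-∞,k₀] ∩ ℤ)`: the corresponding component of
the full-lattice operator with `α_{k₀+1} = e^{it}`, which decouples between `k₀` and `k₀ + 1`. -/
def opUMinus (α : ℤ → ℂ) (hα : ∀ k, ‖α k‖ ≤ 1) (t : ℝ) (k₀ : ℤ) :
    ℓ²(Set.Iic k₀, ℂ) →L[ℂ] ℓ²(Set.Iic k₀, ℂ) :=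
  restrict (Set.Iic k₀) ∘L opU (setCoeff α (k₀ + 1) t) (setCoeff_norm_le hα (k₀ + 1) t) ∘L
    extend (Set.Iic k₀)

/-! ### Resolvents and matrix entries -/

/-- The standard basis vector `δ_k`. -/
def delta {S : Type} [DecidableEq S] (k : S) : ℓ²(S, ℂ) := lp.single 2 k 1

/-- The matrix entry `A(k, k') = (δ_k, A δ_{k'})` (scalar product linear in the second argument). -/
def entry {S : Type} [DecidableEq S] (A : ℓ²(S, ℂ) →L[ℂ] ℓ²(S, ℂ)) (k k' : S) : ℂ :=
  inner ℂ (delta k) (A (delta k'))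

/-- The resolvent `(A - z I)⁻¹` (for `z` in the resolvent set of `A`). -/
def res {S : Type} (A : ℓ²(S, ℂ) →L[ℂ] ℓ²(S, ℂ)) (z : ℂ) : ℓ²(S, ℂ) →L[ℂ] ℓ²(S, ℂ) :=
  Ring.inverse (A - z • 1)

/-! ### Solutions of the transfer matrix recursion -/

open Classical in
/-- The transfer matrix `T(z,k)`. -/
def transfer (α : ℤ → ℂ) (z : ℂ) (k : ℤ) : Matrix (Fin 2) (Fin 2) ℂ :=
  if Odd k then (1 / (rho α k : ℂ)) • !![α k, z; 1 / z, conj (α k)]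
  else (1 / (rho α k : ℂ)) • !![conj (α k), 1; 1, α k]

/-- `n` steps to the right, starting from the value `w` at `k₀`. -/
def forward (α : ℤ → ℂ) (z : ℂ) (k₀ : ℤ) (w : Fin 2 → ℂ) : ℕ → Fin 2 → ℂ
  | 0 => w
  | n + 1 => transfer α z (k₀ + n + 1) *ᵥ forward α z k₀ w n

/-- `n` steps to the left, starting from the value `w` at `k₀`. -/
def backward (α : ℤ → ℂ) (z : ℂ) (k₀ : ℤ) (w : Fin 2 → ℂ) : ℕ → Fin 2 → ℂ
  | 0 => w
  | n + 1 => (transfer α z (k₀ - n))⁻¹ *ᵥ backward α z k₀ w n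

/-- The solution `Y` of `Y(k) = T(z,k) Y(k-1)`, `k ∈ ℤ`, with `Y(k₀) = w`. -/
def sol (α : ℤ → ℂ) (z : ℂ) (k₀ : ℤ) (w : Fin 2 → ℂ) (k : ℤ) : Fin 2 → ℂ :=
  if k₀ ≤ k then forward α z k₀ w (k - k₀).toNat else backward α z k₀ w (k₀ - k).toNat

theorem sol_self (α : ℤ → ℂ) (z : ℂ) (k₀ : ℤ) (w : Fin 2 → ℂ) : sol α z k₀ w k₀ = w := by
  simp [sol, forward]

theorem isUnit_det_transfer {α : ℤ → ℂ} (hα : ∀ k, ‖α k‖ < 1) {z : ℂ} (hz : z ≠ 0) (k : ℤ) :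
    IsUnit (transfer α z k).det := by
  have h0 : 0 < 1 - ‖α k‖ ^ 2 := by nlinarith [hα k, norm_nonneg (α k)]
  have hr : (rho α k : ℂ) ≠ 0 := by
    exact_mod_cast (Real.sqrt_pos.2 h0).ne'
  have h1 : α k * conj (α k) - 1 ≠ 0 := by
    rw [Complex.mul_conj, Complex.normSq_eq_norm_sq]
    intro h
    have h2 : ‖α k‖ ^ 2 - 1 = 0 := by exact_mod_cast h
    linarith
  rw [isUnit_iff_ne_zero, transfer]
  split_ifs
  · rw [Matrix.det_smul, Matrix.det_fin_two_of, mul_one_div_cancel hz]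
    simp [hr, h1]
  · rw [Matrix.det_smul, Matrix.det_fin_two_of, mul_one, mul_comm (conj _)]
    simp [hr, h1]

theorem sol_step {α : ℤ → ℂ} (hα : ∀ k, ‖α k‖ < 1) {z : ℂ} (hz : z ≠ 0) (k₀ : ℤ) (w : Fin 2 → ℂ)
    (k : ℤ) : sol α z k₀ w k = transfer α z k *ᵥ sol α z k₀ w (k - 1) := by
  by_cases h : k₀ < k
  · obtain ⟨n, rfl⟩ : ∃ n : ℕ, k = k₀ + n + 1 := ⟨(k - k₀ - 1).toNat, by omega⟩
    have e1 : (k₀ + n + 1 - k₀).toNat = n + 1 := by omega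
    have e2 : (k₀ + n + 1 - 1 - k₀).toNat = n := by omega
    rw [sol, sol, if_pos (by omega), if_pos (by omega), e1, e2, forward]
  · obtain ⟨n, rfl⟩ : ∃ n : ℕ, k = k₀ - n := ⟨(k₀ - k).toNat, by omega⟩
    have e1 : sol α z k₀ w (k₀ - n) = backward α z k₀ w n := by
      rcases Nat.eq_zero_or_pos n with rfl | hn
      · simp [sol, forward, backward]
      · rw [sol, if_neg (by omega)]
        congr 1
        omega
    have e2 : (k₀ - (k₀ - n - 1)).toNat = n + 1 := by omega
    rw [e1, sol, if_neg (by omega), e2, backward, Matrix.mulVec_mulVec,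
      Matrix.mul_nonsing_inv _ (isUnit_det_transfer hα hz _), Matrix.one_mulVec]

/-- `γ = e^{-it/2}`. -/
def gam (t : ℝ) : ℂ := Complex.exp (-(Complex.I * t / 2))

/-- The solution `(p₊, r₊)`. -/
def solPRPlus (α : ℤ → ℂ) (t : ℝ) (z : ℂ) (k₀ : ℤ) : ℤ → Fin 2 → ℂ :=
  open Classical in
  sol α z k₀ (if Odd k₀ then ![z * conj (gam t), gam t] else ![gam t, conj (gam t)])

/-- The solution `(q₊, s₊)`. -/
def solQSPlus (α : ℤ → ℂ) (t : ℝ) (z : ℂ) (k₀ : ℤ) : ℤ → Fin 2 → ℂ :=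
  open Classical in
  sol α z k₀ (if Odd k₀ then ![z * conj (gam t), -gam t] else ![-gam t, conj (gam t)])

/-- The solution `(p₋, r₋)`. -/
def solPRMinus (α : ℤ → ℂ) (t : ℝ) (z : ℂ) (k₀ : ℤ) : ℤ → Fin 2 → ℂ :=
  open Classical in
  sol α z k₀ (if Odd k₀ then ![conj (gam t), -gam t] else ![-z * gam t, conj (gam t)])

/-- The solution `(q₋, s₋)`. -/
def solQSMinus (α : ℤ → ℂ) (t : ℝ) (z : ℂ) (k₀ : ℤ) : ℤ → Fin 2 → ℂ :=
  open Classical in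
  sol α z k₀ (if Odd k₀ then ![conj (gam t), gam t] else ![z * gam t, conj (gam t)])

/-- `p₊(z,k,k₀)` -/
def pPlus (α : ℤ → ℂ) (t : ℝ) (z : ℂ) (k₀ k : ℤ) : ℂ := solPRPlus α t z k₀ k 0
/-- `r₊(z,k,k₀)` -/
def rPlus (α : ℤ → ℂ) (t : ℝ) (z : ℂ) (k₀ k : ℤ) : ℂ := solPRPlus α t z k₀ k 1
/-- `q₊(z,k,k₀)` -/
def qPlus (α : ℤ → ℂ) (t : ℝ) (z : ℂ) (k₀ k : ℤ) : ℂ := solQSPlus α t z k₀ k 0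
/-- `s₊(z,k,k₀)` -/
def sPlus (α : ℤ → ℂ) (t : ℝ) (z : ℂ) (k₀ k : ℤ) : ℂ := solQSPlus α t z k₀ k 1
/-- `p₋(z,k,k₀)` -/
def pMinus (α : ℤ → ℂ) (t : ℝ) (z : ℂ) (k₀ k : ℤ) : ℂ := solPRMinus α t z k₀ k 0
/-- `r₋(z,k,k₀)` -/
def rMinus (α : ℤ → ℂ) (t : ℝ) (z : ℂ) (k₀ k : ℤ) : ℂ := solPRMinus α t z k₀ k 1
/-- `q₋(z,k,k₀)` -/
def qMinus (α : ℤ → ℂ) (t : ℝ) (z : ℂ) (k₀ k : ℤ) : ℂ := solQSMinus α t z k₀ k 0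
/-- `s₋(z,k,k₀)` -/
def sMinus (α : ℤ → ℂ) (t : ℝ) (z : ℂ) (k₀ k : ℤ) : ℂ := solQSMinus α t z k₀ k 1

/-! ### Half-lattice `m`-functions and the solutions `û±`, `v̂±` -/

/-- `m₊(z,k₀) = (δ_{k₀}, (U₊ + z)(U₊ - z)⁻¹ δ_{k₀})`. -/
def mPlus (α : ℤ → ℂ) (hα : ∀ k, ‖α k‖ ≤ 1) (t : ℝ) (z : ℂ) (k₀ : ℤ) : ℂ :=
  entry ((opUPlus α hα t k₀ + z • 1) ∘L res (opUPlus α hα t k₀) z)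
    ⟨k₀, Set.self_mem_Ici⟩ ⟨k₀, Set.self_mem_Ici⟩

/-- `m₋(z,k₀) = -(δ_{k₀}, (U₋ + z)(U₋ - z)⁻¹ δ_{k₀})`. -/
def mMinus (α : ℤ → ℂ) (hα : ∀ k, ‖α k‖ ≤ 1) (t : ℝ) (z : ℂ) (k₀ : ℤ) : ℂ :=
  -entry ((opUMinus α hα t k₀ + z • 1) ∘L res (opUMinus α hα t k₀) z)
    ⟨k₀, Set.self_mem_Iic⟩ ⟨k₀, Set.self_mem_Iic⟩

/-- `û₊ = q₊ + m₊ p₊` -/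
def uHatPlus (α : ℤ → ℂ) (hα : ∀ k, ‖α k‖ ≤ 1) (t : ℝ) (z : ℂ) (k₀ k : ℤ) : ℂ :=
  qPlus α t z k₀ k + mPlus α hα t z k₀ * pPlus α t z k₀ k
/-- `v̂₊ = s₊ + m₊ r₊` -/
def vHatPlus (α : ℤ → ℂ) (hα : ∀ k, ‖α k‖ ≤ 1) (t : ℝ) (z : ℂ) (k₀ k : ℤ) : ℂ :=
  sPlus α t z k₀ k + mPlus α hα t z k₀ * rPlus α t z k₀ k
/-- `û₋ = q₋ + m₋ p₋` -/
def uHatMinus (α : ℤ → ℂ) (hα : ∀ k, ‖α k‖ ≤ 1) (t : ℝ) (z : ℂ) (k₀ k : ℤ) : ℂ :=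
  qMinus α t z k₀ k + mMinus α hα t z k₀ * pMinus α t z k₀ k
/-- `v̂₋ = s₋ + m₋ r₋` -/
def vHatMinus (α : ℤ → ℂ) (hα : ∀ k, ‖α k‖ ≤ 1) (t : ℝ) (z : ℂ) (k₀ k : ℤ) : ℂ :=
  sMinus α t z k₀ k + mMinus α hα t z k₀ * rMinus α t z k₀ k

/-! ### Full-lattice Weyl–Titchmarsh functions and solutions -/

/-- A Caratheodory function: analytic in the open unit disk with non-negative real part there,
extended to `|z| > 1` by `F(z) = -conj F(1/conj z)`. -/
def IsCaratheodory (F : ℂ → ℂ) : Prop :=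
  AnalyticOnNhd ℂ F (Metric.ball 0 1) ∧ (∀ z, ‖z‖ < 1 → 0 ≤ (F z).re) ∧
    ∀ z, 1 < ‖z‖ → F z = -conj (F (1 / conj z))

/-- An anti-Caratheodory function: `-F` is a Caratheodory function. -/
def IsAntiCaratheodory (F : ℂ → ℂ) : Prop := IsCaratheodory (fun z => -F z)

/-- `u = q₊ + M p₊` (with `M = M₊` for `u₊` and `M = M₋` for `u₋`). -/
def uSol (α : ℤ → ℂ) (t : ℝ) (M : ℂ → ℂ) (z : ℂ) (k₀ k : ℤ) : ℂ :=
  qPlus α t z k₀ k + M z * pPlus α t z k₀ k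

/-- `v = s₊ + M r₊` (with `M = M₊` for `v₊` and `M = M₋` for `v₋`). -/
def vSol (α : ℤ → ℂ) (t : ℝ) (M : ℂ → ℂ) (z : ℂ) (k₀ k : ℤ) : ℂ :=
  sPlus α t z k₀ k + M z * rPlus α t z k₀ k

/-- The sequence `f` is square summable on `S ⊆ ℤ`. -/
def SqSummableOn (S : Set ℤ) (f : ℤ → ℂ) : Prop := Memℓp (fun k : S => f k) 2

/-- The defining property of the Weyl–Titchmarsh function `M₊(·,k₀)`: it is a Caratheodory function
and `u₊(z,·,k₀)`, `v₊(z,·,k₀)` are square summable near `+∞`. -/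
def IsWeylPlus (α : ℤ → ℂ) (t : ℝ) (k₀ : ℤ) (M : ℂ → ℂ) : Prop :=
  IsCaratheodory M ∧ ∀ z : ℂ, z ≠ 0 → ‖z‖ ≠ 1 →
    SqSummableOn (Set.Ici k₀) (uSol α t M z k₀) ∧ SqSummableOn (Set.Ici k₀) (vSol α t M z k₀)

/-- The defining property of the Weyl–Titchmarsh function `M₋(·,k₀)`: it is an anti-Caratheodory
function and `u₋(z,·,k₀)`, `v₋(z,·,k₀)` are square summable near `-∞`. -/
def IsWeylMinus (α : ℤ → ℂ) (t : ℝ) (k₀ : ℤ) (M : ℂ → ℂ) : Prop :=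
  IsAntiCaratheodory M ∧ ∀ z : ℂ, z ≠ 0 → ‖z‖ ≠ 1 →
    SqSummableOn (Set.Iic k₀) (uSol α t M z k₀) ∧ SqSummableOn (Set.Iic k₀) (vSol α t M z k₀)

/-! ### The Green's function expressions -/

open Classical in
/-- The expression `a` for `k < k'` and for `k = k'` odd, the expression `b` for `k > k'` and for
`k = k'` even. -/
def greenCases (k k' : ℤ) (a b : ℂ) : ℂ := if k < k' ∨ (k = k' ∧ Odd k) then a else b

/-- The expression for `(U₊ - z)⁻¹(k,k')` through `p₊, r₊, û₊, v̂₊`. -/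
def greenPlus (α : ℤ → ℂ) (hα : ∀ k, ‖α k‖ ≤ 1) (t : ℝ) (k₀ k k' : ℤ) (z : ℂ) : ℂ :=
  z ^ (-(k₀ % 2)) / (2 * z) * greenCases k k'
    (pPlus α t z k₀ k * vHatPlus α hα t z k₀ k')
    (uHatPlus α hα t z k₀ k * rPlus α t z k₀ k')

/-- The expression for `(U₊ - z)⁻¹(k,k')` through `p₊, û₊`. -/
def greenPlus' (α : ℤ → ℂ) (hα : ∀ k, ‖α k‖ ≤ 1) (t : ℝ) (k₀ k k' : ℤ) (z : ℂ) : ℂ :=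
  1 / (2 * z) * greenCases k k'
    (-pPlus α t z k₀ k * conj (uHatPlus α hα t (1 / conj z) k₀ k'))
    (uHatPlus α hα t z k₀ k * conj (pPlus α t (1 / conj z) k₀ k'))

/-- The expression for `(U₋ - z)⁻¹(k,k')` through `p₋, r₋, û₋, v̂₋`. -/
def greenMinus (α : ℤ → ℂ) (hα : ∀ k, ‖α k‖ ≤ 1) (t : ℝ) (k₀ k k' : ℤ) (z : ℂ) : ℂ :=
  z ^ (-((k₀ + 1) % 2)) / (2 * z) * greenCases k k'
    (uHatMinus α hα t z k₀ k * rMinus α t z k₀ k')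
    (pMinus α t z k₀ k * vHatMinus α hα t z k₀ k')

/-- The expression for `(U₋ - z)⁻¹(k,k')` through `p₋, û₋`. -/
def greenMinus' (α : ℤ → ℂ) (hα : ∀ k, ‖α k‖ ≤ 1) (t : ℝ) (k₀ k k' : ℤ) (z : ℂ) : ℂ :=
  1 / (2 * z) * greenCases k k'
    (-uHatMinus α hα t z k₀ k * conj (pMinus α t (1 / conj z) k₀ k'))
    (pMinus α t z k₀ k * conj (uHatMinus α hα t (1 / conj z) k₀ k'))

/-- The expression for `(U - z)⁻¹(k,k')` through `u±, v±`. -/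
def greenFull (α : ℤ → ℂ) (t : ℝ) (Mp Mm : ℂ → ℂ) (k₀ k k' : ℤ) (z : ℂ) : ℂ :=
  -z ^ (-(k₀ % 2)) / (2 * z * (Mp z - Mm z)) * greenCases k k'
    (uSol α t Mm z k₀ k * vSol α t Mp z k₀ k')
    (uSol α t Mp z k₀ k * vSol α t Mm z k₀ k')

/-- The expression for `(U - z)⁻¹(k,k')` through `u±`. -/
def greenFull' (α : ℤ → ℂ) (t : ℝ) (Mp Mm : ℂ → ℂ) (k₀ k k' : ℤ) (z : ℂ) : ℂ :=
  greenCases k k'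
    (uSol α t Mm z k₀ k * conj (uSol α t Mp (1 / conj z) k₀ k'))
    (uSol α t Mp z k₀ k * conj (uSol α t Mm (1 / conj z) k₀ k')) / (2 * z * (Mp z - Mm z))

/-- `F` (considered for `z ≠ 0`) extends to an analytic function on `ℂ ∖ ∂𝔻` with the value `c`
at `z = 0`. -/
def ExtendsToZero (F : ℂ → ℂ) (c : ℂ) : Prop :=
  AnalyticOnNhd ℂ (Function.update F 0 c) {z | ‖z‖ ≠ 1}

end CMV

end

noncomputable section

namespace CMV

open scoped lp Matrix ComplexConjugate InnerProductSpace

/-! ### Matrix entries and unitarity -/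

section Entries

variable {S : Type} [DecidableEq S]

/-! Put `v = z⁻¹ W u`. Then `U u = z u` becomes `W u = z v`, `V v = u`, and this system splits into
one 2×2 relation per block `Θ_k` (`BlockRel`). For `|α_k| < 1` the relation is the recursion `Y(k) =
T(z,k) Y(k-1)` (`blockRel_of_transfer`). Unlike the recursion, it still makes sense when `α_k` is
unimodular, so one calculation serves `U` and both half-lattice operators.

The Green's function is the classical one: take a solution `(a,b)` square summable to the left and a
solution `(u,v)` square summable to the right, and glue them at `k'` into `G(k) = a(k) v(k')` or
`u(k) b(k')`. Then `(U - z) G` is `z` times the signed Wronskian times `δ_{k'}` (`opU_green`). The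
Wronskian is constant because the blocks are symmetric (`wronskian_sub_one`), so it can be evaluated
at `k₀`.

On the half-lattice `[k₀,∞)` the left solution is `p₊` cut off at `k₀`: its initial value is the
boundary condition of the decoupled operator (`blockRel_indicator_plus`). The right solution is
`û₊`. It is square summable because it is a multiple of a solution built from `(U₊ - z)⁻¹ δ_{k₀}`,
whose value at `k₀` is expressed through `m₊` (`sqSummableOn_hatPlus`). The other half-lattice is
the mirror image.

For `U` itself, `M₊ = m₊`, since `u₊` and `û₊` are then the same. At `-∞` the square summable
solution is `û₋(z,·,k₀-1)`; carried across the block `Θ_{k₀}` and expanded in `p₊, q₊`, it makes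
`M₋` a Möbius transform of `m₋(z,k₀-1)` (`uSol_weylMinus_eq`). This transform respects the sign of
the real part, which gives the anti-Caratheodory property and, with `Re m₊ > 0` in the disk, `M₊ ≠
M₋`. Uniqueness of `M±` holds since otherwise `p±` would be square summable, and cut off at `k₀` it
would be an eigenvector of a unitary operator with eigenvalue off the unit circle.

The second form of each formula follows from the first by the symmetry `z ↦ 1 / conj z`, which
conjugates and exchanges the components of solutions (`BlockRel.conj`). The extension to `z = 0`
costs nothing: resolvent entries of a unitary operator are analytic there. -/

theorem delta_apply (k j : S) : (delta k : ℓ²(S, ℂ)) j = if j = k then 1 else 0 := by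
  unfold delta
  split_ifs with h
  · subst h; simp
  · exact lp.single_apply_ne 2 _ _ h

theorem inner_delta (k : S) (f : ℓ²(S, ℂ)) : inner ℂ (delta k) f = f k := by
  simp [delta, lp.inner_single_left]

theorem entry_eq (A : ℓ²(S, ℂ) →L[ℂ] ℓ²(S, ℂ)) (k k' : S) : entry A k k' = A (delta k') k :=
  inner_delta _ _

end Entries

/-- Consecutive integers are of opposite kind, as for `Even` and `Odd`. -/
def Alternating (P : ℤ → Prop) : Prop := ∀ k, P (k + 1) ↔ ¬ P k

theorem alternating_even : Alternating Even := fun _ => Int.even_add_one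

theorem alternating_odd : Alternating Odd := fun k => by
  rw [← Int.not_even_iff_odd, ← Int.not_even_iff_odd, Int.even_add_one]

theorem Alternating.sub_one {P : ℤ → Prop} (h : Alternating P) (k : ℤ) : P (k - 1) ↔ ¬ P k := by
  have := h (k - 1)
  rw [sub_add_cancel] at this
  tauto

theorem rho_sq {α : ℤ → ℂ} (hα : ∀ k, ‖α k‖ ≤ 1) (k : ℤ) :
    (rho α k : ℂ) * rho α k = 1 - α k * conj (α k) := by
  have h : 0 ≤ 1 - ‖α k‖ ^ 2 := by nlinarith [hα k, norm_nonneg (α k)]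
  rw [Complex.mul_conj, Complex.normSq_eq_norm_sq, ← Complex.ofReal_mul, rho,
    Real.mul_self_sqrt h]
  push_cast
  ring

theorem rho_conj (α : ℤ → ℂ) (k : ℤ) : rho (fun k => conj (α k)) k = rho α k := by
  simp [rho]

theorem conj_norm_le {α : ℤ → ℂ} (hα : ∀ k, ‖α k‖ ≤ 1) (k : ℤ) : ‖conj (α k)‖ ≤ 1 := by
  simpa using hα k

open Classical in
theorem thetaOp_delta {P : ℤ → Prop} (hP : Alternating P) (α : ℤ → ℂ) (hα : ∀ k, ‖α k‖ ≤ 1)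
    (k : ℤ) : thetaOp P α hα (delta k) =
      if P k then (rho α k : ℂ) • delta (k - 1) + conj (α k) • delta k
      else (-α (k + 1)) • delta k + (rho α (k + 1) : ℂ) • delta (k + 1) := by
  ext i
  rw [thetaOp_apply]
  by_cases hk : P k
  · rw [if_pos hk]
    simp only [lp.coeFn_add, lp.coeFn_smul, Pi.add_apply, Pi.smul_apply, delta_apply, smul_eq_mul]
    by_cases h1 : i = k
    · subst h1
      have : i ≠ i - 1 := by omega
      simp [hk, this]
    by_cases h2 : i = k - 1
    · subst h2; simp [(hP.sub_one k), hk]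
    · have h3 : i + 1 ≠ k := by omega
      have h4 : P i → i - 1 ≠ k := by
        rintro hi rfl
        exact ((hP.sub_one i).1 hk) hi
      split_ifs with hi <;> simp_all
  · rw [if_neg hk]
    simp only [lp.coeFn_add, lp.coeFn_smul, Pi.add_apply, Pi.smul_apply, delta_apply, smul_eq_mul]
    by_cases h1 : i = k
    · subst h1; simp [hk]
    by_cases h2 : i = k + 1
    · subst h2; simp [(hP k), hk]
    · have h3 : i - 1 ≠ k := by omega
      have h4 : ¬ P i → i + 1 ≠ k := by
        rintro hi rfl
        exact hk ((hP i).2 hi)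
      split_ifs with hi <;> simp_all

/-- Each `Θ_k` is symmetric, so the adjoint merely conjugates the entries. Pairing with `delta k`
reduces the claim to the columns given by `thetaOp_delta`. -/
theorem star_thetaOp {P : ℤ → Prop} (hP : Alternating P) (α : ℤ → ℂ) (hα : ∀ k, ‖α k‖ ≤ 1) :
    star (thetaOp P α hα) = thetaOp P (fun k => conj (α k)) (conj_norm_le hα) := by
  ext f k
  rw [← inner_delta, ContinuousLinearMap.star_eq_adjoint, ContinuousLinearMap.adjoint_inner_right,
    thetaOp_delta hP, thetaOp_apply]
  split_ifs <;>
    simp only [inner_add_left, inner_smul_left, inner_delta, rho_conj, map_neg, Complex.conj_conj,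
      Complex.conj_ofReal]

/-- Blockwise this is `|α_k|² + ρ_k² = 1`. Taking `β` with an equation, rather than the conjugate
sequence itself, lets the lemma serve both orders of the product in `thetaOp_mem_unitary`. -/
theorem thetaOp_comp_conj {P : ℤ → Prop} (hP : Alternating P) {α β : ℤ → ℂ}
    (hα : ∀ k, ‖α k‖ ≤ 1) (hβ : ∀ k, ‖β k‖ ≤ 1) (h : ∀ k, β k = conj (α k)) :
    thetaOp P α hα * thetaOp P β hβ = 1 := by
  obtain rfl : β = fun k => conj (α k) := funext h
  ext f k
  rw [mul_apply_eq_comp, thetaOp_apply, one_apply_eq_self]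
  by_cases hk : P k
  · have hk' : ¬ P (k - 1) := by rwa [hP.sub_one, not_not]
    rw [if_pos hk, thetaOp_apply, if_neg hk', thetaOp_apply, if_pos hk]
    simp only [rho_conj, Complex.conj_conj, sub_add_cancel]
    linear_combination f k * rho_sq hα k
  · have hk' : P (k + 1) := by rwa [hP]
    rw [if_neg hk, thetaOp_apply, if_neg hk, thetaOp_apply, if_pos hk']
    simp only [rho_conj, Complex.conj_conj, add_sub_cancel_right]
    linear_combination f k * rho_sq hα (k + 1)

theorem thetaOp_mem_unitary {P : ℤ → Prop} (hP : Alternating P) (α : ℤ → ℂ)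
    (hα : ∀ k, ‖α k‖ ≤ 1) : thetaOp P α hα ∈ unitary (ℓ²(ℤ, ℂ) →L[ℂ] ℓ²(ℤ, ℂ)) := by
  rw [Unitary.mem_iff, star_thetaOp hP]
  exact ⟨thetaOp_comp_conj hP _ _ fun k => by simp, thetaOp_comp_conj hP _ _ fun k => rfl⟩

theorem opU_mem_unitary (α : ℤ → ℂ) (hα : ∀ k, ‖α k‖ ≤ 1) :
    opU α hα ∈ unitary (ℓ²(ℤ, ℂ) →L[ℂ] ℓ²(ℤ, ℂ)) :=
  mul_mem (thetaOp_mem_unitary alternating_even α hα) (thetaOp_mem_unitary alternating_odd α hα)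

/-! ### Decoupling -/

theorem restrict_apply (S : Set ℤ) (f : ℓ²(ℤ, ℂ)) (k : S) : restrict S f k = f k := rfl

theorem extend_apply_of_mem (S : Set ℤ) (f : ℓ²(S, ℂ)) {k : ℤ} (hk : k ∈ S) :
    extend S f k = f ⟨k, hk⟩ := by rw [extend_apply, dif_pos hk]

theorem extend_apply_of_notMem (S : Set ℤ) (f : ℓ²(S, ℂ)) {k : ℤ} (hk : k ∉ S) :
    extend S f k = 0 := by rw [extend_apply, dif_neg hk]

theorem restrict_extend (S : Set ℤ) (f : ℓ²(S, ℂ)) : restrict S (extend S f) = f := by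
  ext k
  rw [restrict_apply, extend_apply_of_mem S f k.2]

theorem extend_restrict {S : Set ℤ} {f : ℓ²(ℤ, ℂ)} (h : ∀ k ∉ S, f k = 0) :
    extend S (restrict S f) = f := by
  ext k
  by_cases hk : k ∈ S
  · rw [extend_apply_of_mem _ _ hk, restrict_apply]
  · rw [extend_apply_of_notMem _ _ hk, h k hk]

theorem extend_delta {S : Set ℤ} [DecidableEq S] (k : S) :
    extend S (delta k) = delta (k : ℤ) := by
  ext j
  rw [delta_apply]
  by_cases hj : j ∈ S
  · rw [extend_apply_of_mem _ _ hj, delta_apply]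
    simp [Subtype.ext_iff]
  · rw [extend_apply_of_notMem _ _ hj, if_neg]
    rintro rfl
    exact hj k.2

theorem restrict_delta {S : Set ℤ} [DecidableEq S] (k : S) :
    restrict S (delta (k : ℤ)) = delta k := by
  rw [← extend_delta, restrict_extend]

/-- The operator `A` maps sequences supported in `S` to sequences supported in `S`. -/
def PreservesSupport (S : Set ℤ) (A : ℓ²(ℤ, ℂ) →L[ℂ] ℓ²(ℤ, ℂ)) : Prop :=
  ∀ f : ℓ²(ℤ, ℂ), (∀ k ∉ S, f k = 0) → ∀ k ∉ S, A f k = 0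

theorem PreservesSupport.mul {S : Set ℤ} {A B : ℓ²(ℤ, ℂ) →L[ℂ] ℓ²(ℤ, ℂ)}
    (hA : PreservesSupport S A) (hB : PreservesSupport S B) : PreservesSupport S (A * B) :=
  fun f hf => hA _ (hB f hf)

/-- The compression of an operator on `ℓ²(ℤ)` to `ℓ²(S)`. -/
def compress (S : Set ℤ) (A : ℓ²(ℤ, ℂ) →L[ℂ] ℓ²(ℤ, ℂ)) : ℓ²(S, ℂ) →L[ℂ] ℓ²(S, ℂ) :=
  restrict S ∘L A ∘L extend S

theorem compress_apply (S : Set ℤ) (A : ℓ²(ℤ, ℂ) →L[ℂ] ℓ²(ℤ, ℂ)) (f : ℓ²(S, ℂ)) :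
    compress S A f = restrict S (A (extend S f)) := rfl

theorem PreservesSupport.extend_compress {S : Set ℤ} {A : ℓ²(ℤ, ℂ) →L[ℂ] ℓ²(ℤ, ℂ)}
    (hA : PreservesSupport S A) (f : ℓ²(S, ℂ)) :
    extend S (compress S A f) = A (extend S f) :=
  extend_restrict (hA _ fun _ => extend_apply_of_notMem S f)

/-- Only the inner factor has to preserve the support: restricting its output to `S` then loses
nothing. -/
theorem PreservesSupport.compress_mul {S : Set ℤ} {A B : ℓ²(ℤ, ℂ) →L[ℂ] ℓ²(ℤ, ℂ)}
    (hB : PreservesSupport S B) : compress S (A * B) = compress S A * compress S B := by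
  ext f : 1
  rw [mul_apply_eq_comp, compress_apply, compress_apply, hB.extend_compress,
    mul_apply_eq_comp]

theorem star_compress (S : Set ℤ) (A : ℓ²(ℤ, ℂ) →L[ℂ] ℓ²(ℤ, ℂ)) :
    star (compress S A) = compress S (star A) := by
  simp only [ContinuousLinearMap.star_eq_adjoint, compress, ContinuousLinearMap.adjoint_comp,
    extend, ContinuousLinearMap.adjoint_adjoint, ContinuousLinearMap.comp_assoc]

theorem compress_one (S : Set ℤ) : compress S 1 = 1 := by
  ext f : 1
  exact restrict_extend S f

/-- The two products of the compression with its adjoint have different inner factors, so both `A`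
and `star A` must preserve the support. -/
theorem compress_mem_unitary {S : Set ℤ} {A : ℓ²(ℤ, ℂ) →L[ℂ] ℓ²(ℤ, ℂ)}
    (hA : A ∈ unitary (ℓ²(ℤ, ℂ) →L[ℂ] ℓ²(ℤ, ℂ))) (h : PreservesSupport S A)
    (h' : PreservesSupport S (star A)) :
    compress S A ∈ unitary (ℓ²(S, ℂ) →L[ℂ] ℓ²(S, ℂ)) := by
  rw [Unitary.mem_iff, star_compress, ← h.compress_mul, ← h'.compress_mul,
    Unitary.star_mul_self_of_mem hA, Unitary.mul_star_self_of_mem hA, compress_one]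
  exact ⟨rfl, rfl⟩

/-- The blocks `Θ_k` which are not diagonal do not couple `S` to its complement. -/
def Decouples (α : ℤ → ℂ) (S : Set ℤ) : Prop := ∀ k, rho α k ≠ 0 → (k - 1 ∈ S ↔ k ∈ S)

theorem Decouples.conj {α : ℤ → ℂ} {S : Set ℤ} (h : Decouples α S) :
    Decouples (fun k => conj (α k)) S := fun k hk => h k (by rwa [rho_conj] at hk)

theorem Decouples.preservesSupport_thetaOp {α : ℤ → ℂ} {S : Set ℤ} (h : Decouples α S)
    (P : ℤ → Prop) (hα : ∀ k, ‖α k‖ ≤ 1) : PreservesSupport S (thetaOp P α hα) := by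
  intro f hf k hk
  rw [thetaOp_apply, hf k hk]
  have h1 : (rho α k : ℂ) * f (k - 1) = 0 := by
    by_cases h0 : rho α k = 0
    · simp [h0]
    · rw [hf (k - 1) (by rwa [h k h0]), mul_zero]
  have h2 : (rho α (k + 1) : ℂ) * f (k + 1) = 0 := by
    by_cases h0 : rho α (k + 1) = 0
    · simp [h0]
    · have := h (k + 1) h0
      rw [add_sub_cancel_right] at this
      rw [hf (k + 1) (by rwa [← this]), mul_zero]
  split_ifs <;> simp [h1, h2]

theorem Decouples.preservesSupport_opU {α : ℤ → ℂ} {S : Set ℤ} (h : Decouples α S)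
    (hα : ∀ k, ‖α k‖ ≤ 1) : PreservesSupport S (opU α hα) :=
  (h.preservesSupport_thetaOp _ hα).mul (h.preservesSupport_thetaOp _ hα)

theorem Decouples.preservesSupport_star_opU {α : ℤ → ℂ} {S : Set ℤ} (h : Decouples α S)
    (hα : ∀ k, ‖α k‖ ≤ 1) : PreservesSupport S (star (opU α hα)) := by
  have e : star (opU α hα) = star (opW α hα) * star (opV α hα) := star_mul _ _
  rw [e, opV, opW, star_thetaOp alternating_even, star_thetaOp alternating_odd]
  exact (h.conj.preservesSupport_thetaOp _ _).mul (h.conj.preservesSupport_thetaOp _ _)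

theorem Decouples.compress_opU_mem_unitary {α : ℤ → ℂ} {S : Set ℤ} (h : Decouples α S)
    (hα : ∀ k, ‖α k‖ ≤ 1) :
    compress S (opU α hα) ∈ unitary (ℓ²(S, ℂ) →L[ℂ] ℓ²(S, ℂ)) :=
  compress_mem_unitary (opU_mem_unitary α hα) (h.preservesSupport_opU hα)
    (h.preservesSupport_star_opU hα)

theorem setCoeff_self (α : ℤ → ℂ) (n : ℤ) (t : ℝ) :
    setCoeff α n t n = Complex.exp (Complex.I * t) := by simp [setCoeff]

theorem setCoeff_of_ne (α : ℤ → ℂ) {n k : ℤ} (t : ℝ) (h : k ≠ n) : setCoeff α n t k = α k := by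
  simp [setCoeff, h]

theorem rho_setCoeff_self (α : ℤ → ℂ) (n : ℤ) (t : ℝ) : rho (setCoeff α n t) n = 0 := by
  rw [rho, setCoeff_self, mul_comm, Complex.norm_exp_ofReal_mul_I]
  simp

theorem decouples_Ici (α : ℤ → ℂ) (k₀ : ℤ) (t : ℝ) :
    Decouples (setCoeff α k₀ t) (Set.Ici k₀) := by
  intro k hk
  have : k ≠ k₀ := by
    rintro rfl
    exact hk (rho_setCoeff_self α k t)
  simp only [Set.mem_Ici]
  omega

theorem decouples_Iic (α : ℤ → ℂ) (k₀ : ℤ) (t : ℝ) :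
    Decouples (setCoeff α (k₀ + 1) t) (Set.Iic k₀) := by
  intro k hk
  have : k ≠ k₀ + 1 := by
    rintro rfl
    exact hk (rho_setCoeff_self α _ t)
  simp only [Set.mem_Iic]
  omega

theorem opUPlus_mem_unitary (α : ℤ → ℂ) (hα : ∀ k, ‖α k‖ ≤ 1) (t : ℝ) (k₀ : ℤ) :
    opUPlus α hα t k₀ ∈ unitary (ℓ²(Set.Ici k₀, ℂ) →L[ℂ] ℓ²(Set.Ici k₀, ℂ)) :=
  (decouples_Ici α k₀ t).compress_opU_mem_unitary _

theorem opUMinus_mem_unitary (α : ℤ → ℂ) (hα : ∀ k, ‖α k‖ ≤ 1) (t : ℝ) (k₀ : ℤ) :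
    opUMinus α hα t k₀ ∈ unitary (ℓ²(Set.Iic k₀, ℂ) →L[ℂ] ℓ²(Set.Iic k₀, ℂ)) :=
  (decouples_Iic α k₀ t).compress_opU_mem_unitary _

/-! ### Resolvents of unitary operators -/

section Resolvent

variable {S : Type}

theorem isUnit_sub_of_mem_unitary {A : ℓ²(S, ℂ) →L[ℂ] ℓ²(S, ℂ)}
    (hA : A ∈ unitary (ℓ²(S, ℂ) →L[ℂ] ℓ²(S, ℂ))) {z : ℂ} (hz : ‖z‖ ≠ 1) :
    IsUnit (A - z • 1) := by
  have h : z ∉ spectrum ℂ A := fun h => hz (spectrum.norm_eq_one_of_unitary hA h)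
  rw [spectrum.notMem_iff, Algebra.algebraMap_eq_smul_one] at h
  simpa using h.neg

theorem sub_smul_res_apply {A : ℓ²(S, ℂ) →L[ℂ] ℓ²(S, ℂ)} {z : ℂ} (h : IsUnit (A - z • 1))
    (x : ℓ²(S, ℂ)) : A (res A z x) - z • res A z x = x := by
  have := congrArg (fun B => B x) (Ring.mul_inverse_cancel _ h)
  simpa [mul_apply_eq_comp, sub_apply, res] using this

theorem res_eq {A : ℓ²(S, ℂ) →L[ℂ] ℓ²(S, ℂ)} {z : ℂ} (h : IsUnit (A - z • 1))
    {x y : ℓ²(S, ℂ)} (hxy : A x - z • x = y) : res A z y = x := by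
  have := congrArg (fun B => B x) (Ring.inverse_mul_cancel _ h)
  rw [← hxy]
  simpa [mul_apply_eq_comp, sub_apply, res] using this

theorem eq_zero_of_apply_eq_smul {A : ℓ²(S, ℂ) →L[ℂ] ℓ²(S, ℂ)} {z : ℂ} (h : IsUnit (A - z • 1))
    {x : ℓ²(S, ℂ)} (hx : A x = z • x) : x = 0 := by
  rw [← res_eq h (sub_eq_zero.2 hx), map_zero]

theorem analyticAt_res {A : ℓ²(S, ℂ) →L[ℂ] ℓ²(S, ℂ)} {z : ℂ} (h : IsUnit (A - z • 1)) :
    AnalyticAt ℂ (res A) z := by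
  have h1 : AnalyticAt ℂ (fun w : ℂ => A - w • (1 : ℓ²(S, ℂ) →L[ℂ] ℓ²(S, ℂ))) z := by fun_prop
  exact (analyticOnNhd_inverse (𝕜 := ℂ) _ h).fun_comp_of_eq h1 rfl

variable [DecidableEq S]

theorem analyticAt_entry_res {A : ℓ²(S, ℂ) →L[ℂ] ℓ²(S, ℂ)} {z : ℂ} (h : IsUnit (A - z • 1))
    (k k' : S) : AnalyticAt ℂ (fun w => entry (res A w) k k') z := by
  let L : (ℓ²(S, ℂ) →L[ℂ] ℓ²(S, ℂ)) →L[ℂ] ℂ :=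
    innerSL ℂ (delta k) ∘L ContinuousLinearMap.apply ℂ ℓ²(S, ℂ) (delta k')
  exact (L.analyticAt _).comp (analyticAt_res h)

/-- The function `z ↦ (δ_k, (A + z)(A - z)⁻¹ δ_k)`. -/
def mFun (A : ℓ²(S, ℂ) →L[ℂ] ℓ²(S, ℂ)) (k : S) (z : ℂ) : ℂ :=
  entry ((A + z • 1) ∘L res A z) k k

/-- From `A + z = (A - z) + 2z`. This ties the value of the resolvent vector at `k` to the
`m`-function. -/
theorem mFun_eq {A : ℓ²(S, ℂ) →L[ℂ] ℓ²(S, ℂ)} {z : ℂ} (h : IsUnit (A - z • 1)) (k : S) :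
    mFun A k z = 1 + 2 * z * entry (res A z) k k := by
  have h1 := congrArg (fun f : ℓ²(S, ℂ) => f k) (sub_smul_res_apply h (delta k))
  simp only [lp.coeFn_sub, lp.coeFn_smul, Pi.sub_apply, Pi.smul_apply, smul_eq_mul, delta_apply,
    if_true] at h1
  rw [mFun, entry_eq, entry_eq]
  simp only [ContinuousLinearMap.comp_apply, add_apply, smul_apply, one_apply_eq_self,
    lp.coeFn_add, lp.coeFn_smul, Pi.add_apply, Pi.smul_apply, smul_eq_mul]
  linear_combination h1

theorem analyticAt_mFun {A : ℓ²(S, ℂ) →L[ℂ] ℓ²(S, ℂ)}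
    (hA : A ∈ unitary (ℓ²(S, ℂ) →L[ℂ] ℓ²(S, ℂ))) (k : S) {z : ℂ} (hz : ‖z‖ ≠ 1) :
    AnalyticAt ℂ (mFun A k) z := by
  have h1 := analyticAt_entry_res (isUnit_sub_of_mem_unitary hA hz) k k
  have h2 : AnalyticAt ℂ (fun w => 1 + 2 * w * entry (res A w) k k) z := by fun_prop
  refine h2.congr ?_
  have ho : IsOpen {w : ℂ | ‖w‖ ≠ 1} := isOpen_ne_fun (by fun_prop) (by fun_prop)
  filter_upwards [ho.mem_nhds hz] with w hw
  exact (mFun_eq (isUnit_sub_of_mem_unitary hA hw) k).symm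

/-- With `g = (A - z)⁻¹ δ_k`, the function is `((A - z)g, (A + z)g)`. As `A` is isometric, the
diagonal terms give `(1 - |z|²)‖g‖²`, and the cross terms are purely imaginary. -/
theorem mFun_re {A : ℓ²(S, ℂ) →L[ℂ] ℓ²(S, ℂ)}
    (hA : A ∈ unitary (ℓ²(S, ℂ) →L[ℂ] ℓ²(S, ℂ))) (k : S) {z : ℂ} (hz : ‖z‖ ≠ 1) :
    (mFun A k z).re = (1 - ‖z‖ ^ 2) * ‖res A z (delta k)‖ ^ 2 := by
  have h1 := sub_smul_res_apply (isUnit_sub_of_mem_unitary hA hz) (delta k)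
  set g := res A z (delta k)
  have h2 : mFun A k z = inner ℂ (A g - z • g) (A g + z • g) := by
    rw [h1]; rfl
  have h3 : inner ℂ (A g) (A g) = inner ℂ g g :=
    ContinuousLinearMap.inner_map_map_of_mem_unitary hA g g
  have h4 : (inner ℂ (A g) g : ℂ) = conj (inner ℂ g (A g)) := (inner_conj_symm _ _).symm
  have h5 : (z * inner ℂ (A g) g).re = (conj z * inner ℂ g (A g)).re := by
    rw [h4, ← Complex.conj_re, map_mul, Complex.conj_conj]
  have h6 : (inner ℂ g g : ℂ) = ((‖g‖ ^ 2 : ℝ) : ℂ) := by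
    rw [inner_self_eq_norm_sq_to_K, Complex.ofReal_pow]
    rfl
  rw [h2, inner_sub_left, inner_add_right, inner_add_right, inner_smul_left, inner_smul_left,
    inner_smul_right, inner_smul_right, h3, h6, ← mul_assoc, Complex.conj_mul',
    ← Complex.ofReal_pow, ← Complex.ofReal_mul]
  simp only [Complex.sub_re, Complex.add_re, h5, Complex.ofReal_re]
  ring

theorem mFun_re_pos {A : ℓ²(S, ℂ) →L[ℂ] ℓ²(S, ℂ)}
    (hA : A ∈ unitary (ℓ²(S, ℂ) →L[ℂ] ℓ²(S, ℂ))) (k : S) {z : ℂ} (hz : ‖z‖ < 1) :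
    0 < (mFun A k z).re := by
  rw [mFun_re hA k hz.ne]
  have h1 := sub_smul_res_apply (isUnit_sub_of_mem_unitary hA hz.ne) (delta k)
  have h2 : res A z (delta k) ≠ 0 := by
    intro h
    rw [h, map_zero, smul_zero, sub_zero] at h1
    simpa [delta_apply] using congrArg (fun f : ℓ²(S, ℂ) => f k) h1
  have h3 : 0 < ‖res A z (delta k)‖ := norm_pos_iff.2 h2
  have h4 : 0 < 1 - ‖z‖ ^ 2 := by nlinarith [norm_nonneg z]
  positivity

theorem norm_one_div_conj (z : ℂ) : ‖1 / conj z‖ = 1 / ‖z‖ := by simp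

theorem norm_one_div_conj_ne_one {z : ℂ} (hz : ‖z‖ ≠ 1) : ‖1 / conj z‖ ≠ 1 := by
  simpa [norm_one_div_conj] using hz

theorem one_div_conj_one_div_conj (z : ℂ) : 1 / conj (1 / conj z) = z := by simp

/-- Both values are expressed through the two resolvent vectors at `z` and `1 / conj z`. The terms
containing `(g', g)` cancel because `conj w * z = 1`, and the remaining cross terms change sign. -/
theorem mFun_conj {A : ℓ²(S, ℂ) →L[ℂ] ℓ²(S, ℂ)}
    (hA : A ∈ unitary (ℓ²(S, ℂ) →L[ℂ] ℓ²(S, ℂ))) (k : S) {z : ℂ} (hz0 : z ≠ 0) (hz : ‖z‖ ≠ 1) :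
    conj (mFun A k (1 / conj z)) = -mFun A k z := by
  have h1 := sub_smul_res_apply (isUnit_sub_of_mem_unitary hA hz) (delta k)
  have h2 := sub_smul_res_apply
    (isUnit_sub_of_mem_unitary hA (norm_one_div_conj_ne_one hz)) (delta k)
  set w := 1 / conj z with hw
  have hwz : conj w * z = 1 := by simp [hw, hz0]
  set g := res A z (delta k)
  set g' := res A w (delta k)
  have e1 : mFun A k z = inner ℂ (A g' - w • g') (A g + z • g) := by
    rw [h2]; rfl
  have e2 : mFun A k w = inner ℂ (A g - z • g) (A g' + w • g') := by
    rw [h1]; rfl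
  have h3 : inner ℂ (A g') (A g) = inner ℂ g' g :=
    ContinuousLinearMap.inner_map_map_of_mem_unitary hA g' g
  rw [e2, inner_conj_symm, e1]
  simp only [inner_sub_left, inner_sub_right, inner_add_right, inner_add_left, inner_smul_left,
    inner_smul_right, h3]
  linear_combination (-2 * inner ℂ g' g) * hwz

theorem mFun_re_neg {A : ℓ²(S, ℂ) →L[ℂ] ℓ²(S, ℂ)}
    (hA : A ∈ unitary (ℓ²(S, ℂ) →L[ℂ] ℓ²(S, ℂ))) (k : S) {z : ℂ} (hz : 1 < ‖z‖) :
    (mFun A k z).re < 0 := by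
  have h0 : z ≠ 0 := norm_pos_iff.1 (by linarith)
  have h := mFun_conj hA k h0 hz.ne'
  have h1 : 0 < (mFun A k (1 / conj z)).re := by
    refine mFun_re_pos hA k ?_
    rw [norm_one_div_conj, div_lt_one (by linarith)]
    exact hz
  have h2 := congrArg Complex.re h
  rw [Complex.conj_re, Complex.neg_re] at h2
  linarith

theorem isCaratheodory_mFun {A : ℓ²(S, ℂ) →L[ℂ] ℓ²(S, ℂ)}
    (hA : A ∈ unitary (ℓ²(S, ℂ) →L[ℂ] ℓ²(S, ℂ))) (k : S) : IsCaratheodory (mFun A k) := by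
  refine ⟨fun z hz => analyticAt_mFun hA k (mem_ball_zero_iff.1 hz).ne,
    fun z hz => (mFun_re_pos hA k hz).le, fun z hz => ?_⟩
  rw [mFun_conj hA k (norm_pos_iff.1 (by linarith)) hz.ne', neg_neg]

end Resolvent

theorem isOpen_norm_ne_one : IsOpen {z : ℂ | ‖z‖ ≠ 1} :=
  isOpen_ne_fun (by fun_prop) (by fun_prop)

/-- The resolvent set of a unitary operator contains `0`, so analyticity is inherited from the
resolvent entry and no pole of `F` has to be cancelled by hand. The meaningless value of `F` at `0`
is overwritten by the update. -/
theorem extendsToZero_of_eq_entry_res {S : Type} [DecidableEq S] {A : ℓ²(S, ℂ) →L[ℂ] ℓ²(S, ℂ)}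
    (hA : A ∈ unitary (ℓ²(S, ℂ) →L[ℂ] ℓ²(S, ℂ))) (k k' : S) {F : ℂ → ℂ}
    (hF : ∀ z : ℂ, z ≠ 0 → ‖z‖ ≠ 1 → entry (res A z) k k' = F z) :
    ExtendsToZero F (entry (res A 0) k k') := by
  have h : AnalyticOnNhd ℂ (fun z => entry (res A z) k k') {z | ‖z‖ ≠ 1} :=
    fun z hz => analyticAt_entry_res (isUnit_sub_of_mem_unitary hA hz) k k'
  refine h.congr isOpen_norm_ne_one fun z hz => ?_
  by_cases h0 : z = 0
  · subst h0; simp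
  · rw [Function.update_of_ne h0]
    exact hF z h0 hz

/-- The definition prescribes the reflection only for `|z| > 1`. Inside the disk it follows because
`z ↦ 1 / conj z` is an involution. -/
theorem IsCaratheodory.conj_apply {F : ℂ → ℂ} (hF : IsCaratheodory F) {z : ℂ} (h0 : z ≠ 0)
    (hz : ‖z‖ ≠ 1) : conj (F (1 / conj z)) = -F z := by
  rcases hz.lt_or_gt with h | h
  · have h1 : 1 < ‖1 / conj z‖ := by
      rw [norm_one_div_conj, lt_div_iff₀ (norm_pos_iff.2 h0), one_mul]
      exact h
    rw [hF.2.2 _ h1, one_div_conj_one_div_conj, map_neg, Complex.conj_conj]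
  · rw [hF.2.2 z h, neg_neg]

theorem IsAntiCaratheodory.conj_apply {F : ℂ → ℂ} (hF : IsAntiCaratheodory F) {z : ℂ}
    (h0 : z ≠ 0) (hz : ‖z‖ ≠ 1) : conj (F (1 / conj z)) = -F z := by
  have := IsCaratheodory.conj_apply hF h0 hz
  rw [map_neg] at this
  linear_combination -this

/-- Two functions which are analytic in the unit disk and agree off `0` and the unit circle agree
at `0` as well. -/
theorem eq_off_circle_of_eq_off_zero {F G : ℂ → ℂ} (hF : AnalyticOnNhd ℂ F (Metric.ball 0 1))
    (hG : AnalyticOnNhd ℂ G (Metric.ball 0 1)) (h : ∀ z : ℂ, z ≠ 0 → ‖z‖ ≠ 1 → F z = G z)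
    (z : ℂ) (hz : ‖z‖ ≠ 1) : F z = G z := by
  by_cases h0 : z = 0
  · subst h0
    have hm : (0 : ℂ) ∈ Metric.ball (0 : ℂ) 1 := by simp
    have he : F =ᶠ[nhdsWithin 0 {0}ᶜ] G := by
      filter_upwards [self_mem_nhdsWithin,
        nhdsWithin_le_nhds (isOpen_norm_ne_one.mem_nhds (show ‖(0 : ℂ)‖ ≠ 1 by simp))] with w h1 h2
      exact h w h1 h2
    exact (((hF 0 hm).continuousAt.eventuallyEq_nhds_iff_eventuallyEq_nhdsNE
      (hG 0 hm).continuousAt).1 he).eq_of_nhds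
  · exact h z h0 hz

/-! ### Block relations and Wronskians -/

/-- The block relation `Θ_k (u(k-1), u(k)) = z (v(k-1), v(k))` for odd `k`, and
`Θ_k (v(k-1), v(k)) = (u(k-1), u(k))` for even `k`. -/
def BlockRel (α : ℤ → ℂ) (z : ℂ) (k : ℤ) (u v : ℤ → ℂ) : Prop :=
  (Odd k → -α k * u (k - 1) + rho α k * u k = z * v (k - 1) ∧
    rho α k * u (k - 1) + conj (α k) * u k = z * v k) ∧
  (Even k → -α k * v (k - 1) + rho α k * v k = u (k - 1) ∧
    rho α k * v (k - 1) + conj (α k) * v k = u k)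

/-- Passes between `α` and `setCoeff α n t` at every block other than `n`. -/
theorem BlockRel.congr_coeff {α β : ℤ → ℂ} {z : ℂ} {k : ℤ} {u v : ℤ → ℂ}
    (h : BlockRel α z k u v) (hαβ : α k = β k) : BlockRel β z k u v := by
  have hr : rho α k = rho β k := by rw [rho, rho, hαβ]
  rwa [BlockRel, hαβ, hr] at h

theorem BlockRel.congr {α : ℤ → ℂ} {z : ℂ} {k : ℤ} {u v u' v' : ℤ → ℂ}
    (h : BlockRel α z k u v) (h1 : u (k - 1) = u' (k - 1)) (h2 : v (k - 1) = v' (k - 1))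
    (h3 : u k = u' k) (h4 : v k = v' k) : BlockRel α z k u' v' := by
  rwa [BlockRel, h1, h2, h3, h4] at h

theorem BlockRel.of_eq_zero {α : ℤ → ℂ} {z : ℂ} {k : ℤ} {u v : ℤ → ℂ}
    (h1 : u (k - 1) = 0) (h2 : v (k - 1) = 0) (h3 : u k = 0) (h4 : v k = 0) :
    BlockRel α z k u v := by
  simp [BlockRel, h1, h2, h3, h4]

theorem BlockRel.linear_comb {α : ℤ → ℂ} {z : ℂ} {k : ℤ} {u v u' v' : ℤ → ℂ}
    (h : BlockRel α z k u v) (h' : BlockRel α z k u' v') (c d : ℂ) :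
    BlockRel α z k (fun k => c * u k + d * u' k) (fun k => c * v k + d * v' k) := by
  refine ⟨fun hk => ⟨?_, ?_⟩, fun hk => ⟨?_, ?_⟩⟩
  · linear_combination c * (h.1 hk).1 + d * (h'.1 hk).1
  · linear_combination c * (h.1 hk).2 + d * (h'.1 hk).2
  · linear_combination c * (h.2 hk).1 + d * (h'.2 hk).1
  · linear_combination c * (h.2 hk).2 + d * (h'.2 hk).2

theorem BlockRel.const_mul {α : ℤ → ℂ} {z : ℂ} {k : ℤ} {u v : ℤ → ℂ}
    (h : BlockRel α z k u v) (c : ℂ) :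
    BlockRel α z k (fun k => c * u k) (fun k => c * v k) := by
  simpa using h.linear_comb h c 0

theorem rho_ne_zero {α : ℤ → ℂ} {k : ℤ} (hα : ‖α k‖ < 1) : (rho α k : ℂ) ≠ 0 := by
  have h0 : 0 < 1 - ‖α k‖ ^ 2 := by nlinarith [hα, norm_nonneg (α k)]
  exact_mod_cast (Real.sqrt_pos.2 h0).ne'

/-- The transfer matrix is `Θ_k` solved for the values at `k` in terms of those at `k - 1`. One row
is immediate; the other one uses `ρ² = 1 - |α|²` after multiplication by `ρ`. -/
theorem blockRel_of_transfer {α : ℤ → ℂ} (hα : ∀ k, ‖α k‖ < 1) {z : ℂ} (hz : z ≠ 0) {k : ℤ}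
    {Y : ℤ → Fin 2 → ℂ} (hY : Y k = transfer α z k *ᵥ Y (k - 1)) :
    BlockRel α z k (fun k => Y k 0) (fun k => Y k 1) := by
  have hr := rho_ne_zero (hα k)
  have hs := rho_sq (fun k => (hα k).le) k
  refine ⟨fun hk => ?_, fun hk => ?_⟩
  · have h0 : rho α k * Y k 0 = α k * Y (k - 1) 0 + z * Y (k - 1) 1 := by
      rw [hY, transfer, if_pos hk]
      simp [Matrix.mulVec, dotProduct, Fin.sum_univ_two]
      field_simp
    have h1 : rho α k * z * Y k 1 = Y (k - 1) 0 + z * conj (α k) * Y (k - 1) 1 := by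
      rw [hY, transfer, if_pos hk]
      simp [Matrix.mulVec, dotProduct, Fin.sum_univ_two]
      field_simp
    refine ⟨by linear_combination h0, mul_left_cancel₀ hr ?_⟩
    linear_combination conj (α k) * h0 - h1 + Y (k - 1) 0 * hs
  · have hk' : ¬ Odd k := Int.not_odd_iff_even.2 hk
    have h0 : rho α k * Y k 0 = conj (α k) * Y (k - 1) 0 + Y (k - 1) 1 := by
      rw [hY, transfer, if_neg hk']
      simp [Matrix.mulVec, dotProduct, Fin.sum_univ_two]
      field_simp
    have h1 : rho α k * Y k 1 = Y (k - 1) 0 + α k * Y (k - 1) 1 := by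
      rw [hY, transfer, if_neg hk']
      simp [Matrix.mulVec, dotProduct, Fin.sum_univ_two]
      field_simp
    refine ⟨by linear_combination h1, mul_left_cancel₀ hr ?_⟩
    linear_combination conj (α k) * h1 - h0 + Y (k - 1) 1 * hs

theorem blockRel_sol {α : ℤ → ℂ} (hα : ∀ k, ‖α k‖ < 1) {z : ℂ} (hz : z ≠ 0) (k₀ : ℤ)
    (w : Fin 2 → ℂ) (k : ℤ) :
    BlockRel α z k (fun k => sol α z k₀ w k 0) (fun k => sol α z k₀ w k 1) :=
  blockRel_of_transfer hα hz (sol_step hα hz k₀ w k)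

theorem BlockRel.eq_right {α : ℤ → ℂ} {z : ℂ} {k : ℤ} {u v u' v' : ℤ → ℂ} (hα : ‖α k‖ < 1)
    (hz : z ≠ 0) (h : BlockRel α z k u v) (h' : BlockRel α z k u' v')
    (hu : u (k - 1) = u' (k - 1)) (hv : v (k - 1) = v' (k - 1)) : u k = u' k ∧ v k = v' k := by
  have hr := rho_ne_zero hα
  rcases Int.even_or_odd k with hk | hk
  · obtain ⟨h1, h2⟩ := h.2 hk
    obtain ⟨h1', h2'⟩ := h'.2 hk
    rw [hu, hv] at h1
    rw [hv] at h2
    have e : v k = v' k := mul_left_cancel₀ hr (by linear_combination h1 - h1')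
    rw [e] at h2
    exact ⟨by rw [← h2, h2'], e⟩
  · obtain ⟨h1, h2⟩ := h.1 hk
    obtain ⟨h1', h2'⟩ := h'.1 hk
    rw [hu, hv] at h1
    rw [hu] at h2
    have e : u k = u' k := mul_left_cancel₀ hr (by linear_combination h1 - h1')
    rw [e] at h2
    exact ⟨e, mul_left_cancel₀ hz (by rw [← h2, h2'])⟩

theorem BlockRel.eq_left {α : ℤ → ℂ} {z : ℂ} {k : ℤ} {u v u' v' : ℤ → ℂ} (hα : ‖α k‖ < 1)
    (hz : z ≠ 0) (h : BlockRel α z k u v) (h' : BlockRel α z k u' v')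
    (hu : u k = u' k) (hv : v k = v' k) : u (k - 1) = u' (k - 1) ∧ v (k - 1) = v' (k - 1) := by
  have hr := rho_ne_zero hα
  rcases Int.even_or_odd k with hk | hk
  · obtain ⟨h1, h2⟩ := h.2 hk
    obtain ⟨h1', h2'⟩ := h'.2 hk
    rw [hu, hv] at h2
    rw [hv] at h1
    have e : v (k - 1) = v' (k - 1) := mul_left_cancel₀ hr (by linear_combination h2 - h2')
    rw [e] at h1
    exact ⟨by rw [← h1, h1'], e⟩
  · obtain ⟨h1, h2⟩ := h.1 hk
    obtain ⟨h1', h2'⟩ := h'.1 hk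
    rw [hu, hv] at h2
    rw [hu] at h1
    have e : u (k - 1) = u' (k - 1) := mul_left_cancel₀ hr (by linear_combination h2 - h2')
    rw [e] at h1
    exact ⟨e, mul_left_cancel₀ hz (by rw [← h1, h1'])⟩

/-- The half-line form is needed because solutions obtained from a decoupled operator need not
satisfy the relation of the original `α` at the edge block. -/
theorem eq_of_blockRel_right {α : ℤ → ℂ} (hα : ∀ k, ‖α k‖ < 1) {z : ℂ} (hz : z ≠ 0) {k₀ : ℤ}
    {u v u' v' : ℤ → ℂ} (h : ∀ k, k₀ < k → BlockRel α z k u v)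
    (h' : ∀ k, k₀ < k → BlockRel α z k u' v') (hu : u k₀ = u' k₀) (hv : v k₀ = v' k₀)
    (k : ℤ) (hk : k₀ ≤ k) : u k = u' k ∧ v k = v' k := by
  induction k, hk using Int.leInduction with
  | base => exact ⟨hu, hv⟩
  | succ n hn ih =>
    refine (h (n + 1) (by omega)).eq_right (hα _) hz (h' (n + 1) (by omega)) ?_ ?_
    · simpa using ih.1
    · simpa using ih.2

/-- Block `k` links `k - 1` to `k`, so here block `k₀` is included, whereas to the right it is not.
-/
theorem eq_of_blockRel_left {α : ℤ → ℂ} (hα : ∀ k, ‖α k‖ < 1) {z : ℂ} (hz : z ≠ 0) {k₀ : ℤ}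
    {u v u' v' : ℤ → ℂ} (h : ∀ k, k ≤ k₀ → BlockRel α z k u v)
    (h' : ∀ k, k ≤ k₀ → BlockRel α z k u' v') (hu : u k₀ = u' k₀) (hv : v k₀ = v' k₀)
    (k : ℤ) (hk : k ≤ k₀) : u k = u' k ∧ v k = v' k := by
  induction k, hk using Int.leInductionDown with
  | base => exact ⟨hu, hv⟩
  | pred n hn ih => exact (h n hn).eq_left (hα _) hz (h' n hn) ih.1 ih.2

theorem eq_of_blockRel {α : ℤ → ℂ} (hα : ∀ k, ‖α k‖ < 1) {z : ℂ} (hz : z ≠ 0) {k₀ : ℤ}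
    {u v u' v' : ℤ → ℂ} (h : ∀ k, BlockRel α z k u v)
    (h' : ∀ k, BlockRel α z k u' v') (hu : u k₀ = u' k₀) (hv : v k₀ = v' k₀)
    (k : ℤ) : u k = u' k ∧ v k = v' k := by
  rcases le_total k₀ k with hk | hk
  · exact eq_of_blockRel_right hα hz (fun k _ => h k) (fun k _ => h' k) hu hv k hk
  · exact eq_of_blockRel_left hα hz (fun k _ => h k) (fun k _ => h' k) hu hv k hk

/-- The signed Wronskian `(-1)^k (a(k) v(k) - u(k) b(k))` of two pairs of sequences. -/
def wronskian (a b u v : ℤ → ℂ) (k : ℤ) : ℂ := (-1) ^ k * (a k * v k - u k * b k)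

theorem wronskian_of_even {a b u v : ℤ → ℂ} {k : ℤ} (hk : Even k) :
    wronskian a b u v k = a k * v k - u k * b k := by
  rw [wronskian, hk.neg_one_zpow, one_mul]

theorem wronskian_of_odd {a b u v : ℤ → ℂ} {k : ℤ} (hk : Odd k) :
    wronskian a b u v k = u k * b k - a k * v k := by
  rw [wronskian, hk.neg_one_zpow]
  ring

/-- With the alternating sign, the claim says that `a v - u b` sums to zero over the block `{k - 1,
k}`. This is the symmetry of `Θ_k`. Nothing is divided by `ρ_k`, so unimodular coefficients are
allowed. -/
theorem wronskian_sub_one {α : ℤ → ℂ} {z : ℂ} (hz : z ≠ 0) {k : ℤ} {a b u v : ℤ → ℂ}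
    (hab : BlockRel α z k a b) (huv : BlockRel α z k u v) :
    wronskian a b u v k = wronskian a b u v (k - 1) := by
  rcases Int.even_or_odd k with hk | hk
  · have hk' : Odd (k - 1) := hk.sub_odd odd_one
    rw [wronskian_of_even hk, wronskian_of_odd hk']
    obtain ⟨h1, h2⟩ := hab.2 hk
    obtain ⟨h3, h4⟩ := huv.2 hk
    rw [← h1, ← h2, ← h3, ← h4]
    ring
  · have hk' : Even (k - 1) := hk.sub_odd odd_one
    rw [wronskian_of_odd hk, wronskian_of_even hk']
    obtain ⟨h1, h2⟩ := hab.1 hk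
    obtain ⟨h3, h4⟩ := huv.1 hk
    refine mul_left_cancel₀ hz ?_
    linear_combination -u (k - 1) * h1 - u k * h2 + a (k - 1) * h3 + a k * h4

theorem wronskian_eq {α : ℤ → ℂ} {z : ℂ} (hz : z ≠ 0) {m n : ℤ} (hmn : m ≤ n) {a b u v : ℤ → ℂ}
    (hab : ∀ k, m < k → k ≤ n → BlockRel α z k a b)
    (huv : ∀ k, m < k → k ≤ n → BlockRel α z k u v) :
    wronskian a b u v n = wronskian a b u v m := by
  induction n, hmn using Int.leInduction with
  | base => rfl
  | succ n hn ih =>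
    rw [wronskian_sub_one hz (hab (n + 1) (by omega) le_rfl) (huv (n + 1) (by omega) le_rfl),
      add_sub_cancel_right]
    exact ih (fun k h1 h2 => hab k h1 (by omega)) (fun k h1 h2 => huv k h1 (by omega))

/-! ### Square summability -/

theorem sqSummableOn_iff (S : Set ℤ) (f : ℤ → ℂ) :
    SqSummableOn S f ↔ Summable (S.indicator fun k => ‖f k‖ ^ 2) := by
  rw [SqSummableOn, memℓp_gen_iff (p := 2) (by norm_num), ← summable_subtype_iff_indicator]
  simp [Function.comp_def]

theorem sqSummableOn_coe (S : Set ℤ) (f : ℓ²(ℤ, ℂ)) : SqSummableOn S f :=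
  lp.memℓp (restrict S f)

theorem SqSummableOn.congr {S : Set ℤ} {f g : ℤ → ℂ} (hf : SqSummableOn S f)
    (h : ∀ k ∈ S, f k = g k) : SqSummableOn S g := by
  have : (fun k : S => f k) = fun k : S => g k := funext fun k => h k k.2
  rwa [SqSummableOn, this] at hf

theorem SqSummableOn.linear_comb {S : Set ℤ} {f g : ℤ → ℂ} (hf : SqSummableOn S f)
    (hg : SqSummableOn S g) (c d : ℂ) : SqSummableOn S (fun k => c * f k + d * g k) :=
  Memℓp.add (Memℓp.const_smul hf c) (Memℓp.const_smul hg d)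

theorem SqSummableOn.const_mul {S : Set ℤ} {f : ℤ → ℂ} (hf : SqSummableOn S f) (c : ℂ) :
    SqSummableOn S (fun k => c * f k) :=
  Memℓp.const_smul hf c

theorem sqSummableOn_of_eq_zero {S : Set ℤ} {f : ℤ → ℂ} (h : ∀ k ∈ S, f k = 0) :
    SqSummableOn S f := by
  have : (fun k : S => f k) = 0 := funext fun k => h k k.2
  rw [SqSummableOn, this]
  exact zero_memℓp

theorem SqSummableOn.of_finite_diff {S T : Set ℤ} {f : ℤ → ℂ} (hf : SqSummableOn S f)
    (hST : (T \ S ∪ S \ T).Finite) : SqSummableOn T f := by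
  rw [sqSummableOn_iff] at hf ⊢
  refine hf.congr_cofinite ?_
  filter_upwards [hST.compl_mem_cofinite] with k hk
  have : k ∈ S ↔ k ∈ T := by
    simp only [Set.mem_compl_iff, Set.mem_union, Set.mem_sdiff] at hk
    tauto
  by_cases h : k ∈ S
  · rw [Set.indicator_of_mem h, Set.indicator_of_mem (this.1 h)]
  · rw [Set.indicator_of_notMem h, Set.indicator_of_notMem (fun h' => h (this.2 h'))]

theorem SqSummableOn.Ici {m : ℤ} {f : ℤ → ℂ} (hf : SqSummableOn (Set.Ici m) f) (n : ℤ) :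
    SqSummableOn (Set.Ici n) f := by
  refine hf.of_finite_diff ((Set.finite_Icc (min m n) (max m n)).subset fun k hk => ?_)
  simp only [Set.mem_union, Set.mem_sdiff, Set.mem_Ici] at hk
  simp only [Set.mem_Icc]
  omega

theorem SqSummableOn.Iic {m : ℤ} {f : ℤ → ℂ} (hf : SqSummableOn (Set.Iic m) f) (n : ℤ) :
    SqSummableOn (Set.Iic n) f := by
  refine hf.of_finite_diff ((Set.finite_Icc (min m n) (max m n)).subset fun k hk => ?_)
  simp only [Set.mem_union, Set.mem_sdiff, Set.mem_Iic] at hk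
  simp only [Set.mem_Icc]
  omega

theorem SqSummableOn.memℓp_of_support {S : Set ℤ} {f : ℤ → ℂ} (hf : SqSummableOn S f)
    (h : ∀ k ∉ S, f k = 0) : Memℓp f 2 := by
  rw [sqSummableOn_iff] at hf
  rw [memℓp_gen_iff (p := 2) (by norm_num)]
  convert hf using 2 with k
  by_cases hk : k ∈ S
  · rw [Set.indicator_of_mem hk]; simp
  · rw [Set.indicator_of_notMem hk, h k hk]; simp

/-! ### Gluing two sequences at a diagonal index -/

theorem greenCases_left {k k' : ℤ} (h : k < k' ∨ (k = k' ∧ Odd k)) (x y : ℂ) :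
    greenCases k k' x y = x := if_pos h

theorem greenCases_right {k k' : ℤ} (h : k' < k ∨ (k = k' ∧ Even k)) (x y : ℂ) :
    greenCases k k' x y = y := by
  refine if_neg ?_
  rintro (h1 | ⟨h1, h2⟩)
  · omega
  · rcases h with h | ⟨-, h⟩
    · omega
    · exact Int.not_even_iff_odd.2 h2 h

theorem mul_greenCases (k k' : ℤ) (c x y : ℂ) :
    c * greenCases k k' x y = greenCases k k' (c * x) (c * y) := by
  unfold greenCases; split_ifs <;> rfl

/-- Up to constant factors, `a` is used only on `(-∞, k']` and `u` only on `[k', ∞)`. The endpoints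
`m`, `n` are free because moving them changes finitely many terms. -/
theorem memℓp_greenCases {m n : ℤ} {a u : ℤ → ℂ} (ha : SqSummableOn (Set.Iic m) a)
    (hu : SqSummableOn (Set.Ici n) u) (k' : ℤ) (c d : ℂ) :
    Memℓp (fun k => greenCases k k' (a k * c) (u k * d)) 2 := by
  have ha' := (sqSummableOn_iff _ _).1 (ha.Iic k')
  have hu' := (sqSummableOn_iff _ _).1 (hu.Ici k')
  rw [memℓp_gen_iff (p := 2) (by norm_num)]
  refine Summable.of_nonneg_of_le (fun k => by positivity) (fun k => ?_)
    ((ha'.mul_right (‖c‖ ^ 2)).add (hu'.mul_right (‖d‖ ^ 2)))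
  simp only [ENNReal.toReal_ofNat, Real.rpow_ofNat]
  have h1 : 0 ≤ (Set.Iic k').indicator (fun k => ‖a k‖ ^ 2) k :=
    Set.indicator_nonneg (fun _ _ => by positivity) _
  have h2 : 0 ≤ (Set.Ici k').indicator (fun k => ‖u k‖ ^ 2) k :=
    Set.indicator_nonneg (fun _ _ => by positivity) _
  unfold greenCases
  split_ifs with h
  · rw [Set.indicator_of_mem (show k ∈ Set.Iic k' by rw [Set.mem_Iic]; omega), norm_mul, mul_pow]
    exact le_add_of_nonneg_right (by positivity)
  · rw [Set.indicator_of_mem (show k ∈ Set.Ici k' by rw [Set.mem_Ici]; omega), norm_mul, mul_pow]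
    exact le_add_of_nonneg_left (by positivity)

/-! ### Green's functions -/

theorem opU_apply (α : ℤ → ℂ) (hα : ∀ k, ‖α k‖ ≤ 1) (f : ℓ²(ℤ, ℂ)) :
    opU α hα f = opV α hα (opW α hα f) := rfl

theorem opV_apply (α : ℤ → ℂ) (hα : ∀ k, ‖α k‖ ≤ 1) (f : ℓ²(ℤ, ℂ)) (k : ℤ) :
    opV α hα f k = if Even k then rho α k * f (k - 1) + conj (α k) * f k
      else -α (k + 1) * f k + rho α (k + 1) * f (k + 1) := by
  rw [opV]
  convert thetaOp_apply Even α hα f k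

theorem opW_apply (α : ℤ → ℂ) (hα : ∀ k, ‖α k‖ ≤ 1) (f : ℓ²(ℤ, ℂ)) (k : ℤ) :
    opW α hα f k = if Odd k then rho α k * f (k - 1) + conj (α k) * f k
      else -α (k + 1) * f k + rho α (k + 1) * f (k + 1) := by
  rw [opW]
  convert thetaOp_apply Odd α hα f k

/-- The parity convention on the diagonal is made for this step: a block of `W` occupies `(k - 1,
k)` with `k` odd, so an odd `k'` goes with its left neighbour and an even `k'` with its right one,
and no block of `W` sees both solutions. At `k = k'` the two branches of the result coincide. -/
theorem opW_green {α : ℤ → ℂ} (hα : ∀ k, ‖α k‖ ≤ 1) {z : ℂ} {a b u v : ℤ → ℂ} {k' : ℤ}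
    (hab : ∀ k, k ≤ k' → BlockRel α z k a b) (huv : ∀ k, k' < k → BlockRel α z k u v)
    (G : ℓ²(ℤ, ℂ)) (hG : ∀ k, G k = greenCases k k' (a k * v k') (u k * b k')) (k : ℤ) :
    opW α hα G k = z * if k ≤ k' then b k * v k' else v k * b k' := by
  rw [opW_apply]
  by_cases hk : Odd k
  · have hk1 : Even (k - 1) := hk.sub_odd odd_one
    rw [if_pos hk, hG, hG]
    by_cases h : k ≤ k'
    · rw [greenCases_left (.inl (by omega)), if_pos h,
        greenCases_left (by rcases h.lt_or_eq with h | h <;> [exact .inl h; exact .inr ⟨h, hk⟩])]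
      linear_combination v k' * ((hab k h).1 hk).2
    · rw [greenCases_right (by
          rcases (show k' ≤ k - 1 by omega).lt_or_eq with h | h <;>
            [exact .inl h; exact .inr ⟨h.symm, hk1⟩]),
        if_neg h, greenCases_right (.inl (by omega))]
      linear_combination b k' * ((huv k (by omega)).1 hk).2
  · have hk0 : Even k := Int.not_odd_iff_even.1 hk
    have hk1 : Odd (k + 1) := hk0.add_one
    rw [if_neg hk, hG, hG]
    by_cases h : k < k'
    · rw [greenCases_left (.inl h), if_pos h.le, greenCases_left
        (by rcases (show k + 1 ≤ k' by omega).lt_or_eq with h | h <;>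
            [exact .inl h; exact .inr ⟨h, hk1⟩])]
      have := ((hab (k + 1) (by omega)).1 hk1).1
      rw [add_sub_cancel_right] at this
      linear_combination v k' * this
    · have := ((huv (k + 1) (by omega)).1 hk1).1
      rw [add_sub_cancel_right] at this
      have h2 : z * (if k ≤ k' then b k * v k' else v k * b k') = z * (v k * b k') := by
        split_ifs with h3
        · obtain rfl : k = k' := by omega
          ring
        · rfl
      rw [h2, greenCases_right (by
          rcases (show k' ≤ k by omega).lt_or_eq with h | h <;>
            [exact .inl h; exact .inr ⟨h.symm, hk0⟩]),
        greenCases_right (.inl (by omega))]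
      linear_combination b k' * this

/-- After `W` the two branches agree at `k'`, so every block of `V` sees a single solution too and
returns `z G`. The exception is the entry at `k'`, where `V` returns the branch that `G` does not
use there; the difference is `z` times the Wronskian. -/
theorem opU_green {α : ℤ → ℂ} (hα : ∀ k, ‖α k‖ ≤ 1) {z : ℂ} {a b u v : ℤ → ℂ} {k' : ℤ}
    (hab : ∀ k, k ≤ k' → BlockRel α z k a b) (huv : ∀ k, k' < k → BlockRel α z k u v)
    (G : ℓ²(ℤ, ℂ)) (hG : ∀ k, G k = greenCases k k' (a k * v k') (u k * b k')) :
    opU α hα G - z • G = (z * wronskian a b u v k') • delta k' := by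
  ext k
  have hW := opW_green hα hab huv G hG
  simp only [lp.coeFn_sub, lp.coeFn_smul, Pi.sub_apply, Pi.smul_apply, smul_eq_mul, delta_apply]
  rw [opU_apply, opV_apply, hW, hW, hW, hG]
  by_cases hk : Even k
  · rw [if_pos hk]
    by_cases h : k ≤ k'
    · have e := ((hab k h).2 hk).2
      rw [if_pos (show k - 1 ≤ k' by omega), if_pos h]
      rcases h.lt_or_eq with h | rfl
      · rw [greenCases_left (.inl h), if_neg h.ne]
        linear_combination z * v k' * e
      · rw [greenCases_right (.inr ⟨rfl, hk⟩), if_pos rfl, wronskian_of_even hk]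
        linear_combination z * v k * e
    · have e := ((huv k (by omega)).2 hk).2
      have h2 : (if k - 1 ≤ k' then b (k - 1) * v k' else v (k - 1) * b k')
          = v (k - 1) * b k' := by
        split_ifs with h3
        · obtain rfl : k - 1 = k' := by omega
          ring
        · rfl
      rw [h2, if_neg h, greenCases_right (.inl (by omega)), if_neg (by omega)]
      linear_combination z * b k' * e
  · have hk0 : Odd k := Int.not_even_iff_odd.1 hk
    have hk1 : Even (k + 1) := hk0.add_one
    rw [if_neg hk]
    by_cases h : k < k'
    · have e := ((hab (k + 1) (by omega)).2 hk1).1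
      rw [add_sub_cancel_right] at e
      rw [if_pos h.le, if_pos (show k + 1 ≤ k' by omega), greenCases_left (.inl h), if_neg h.ne]
      linear_combination z * v k' * e
    · have e := ((huv (k + 1) (by omega)).2 hk1).1
      rw [add_sub_cancel_right] at e
      rw [if_neg (show ¬ k + 1 ≤ k' by omega)]
      rcases (show k' ≤ k by omega).lt_or_eq with h1 | rfl
      · rw [if_neg (by omega), if_neg (by omega), greenCases_right (.inl h1)]
        linear_combination z * b k' * e
      · rw [if_pos le_rfl, if_pos rfl, greenCases_left (.inr ⟨rfl, hk0⟩), wronskian_of_odd hk0]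
        linear_combination z * b k' * e

theorem entry_res_eq_div {A : ℓ²(ℤ, ℂ) →L[ℂ] ℓ²(ℤ, ℂ)} {z : ℂ} (hA : IsUnit (A - z • 1))
    {c : ℂ} (hc : c ≠ 0) {G : ℓ²(ℤ, ℂ)} {k' : ℤ} (hG : A G - z • G = c • delta k') (k : ℤ) :
    entry (res A z) k k' = G k / c := by
  have h := res_eq hA hG
  rw [map_smul] at h
  rw [entry_eq, ← h, lp.coeFn_smul, Pi.smul_apply, smul_eq_mul, mul_div_cancel_left₀ _ hc]

theorem entry_res_compress_eq_div {S : Set ℤ} [DecidableEq S] {A : ℓ²(ℤ, ℂ) →L[ℂ] ℓ²(ℤ, ℂ)}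
    {z : ℂ} (hA : IsUnit (compress S A - z • 1)) {c : ℂ} (hc : c ≠ 0) {G : ℓ²(ℤ, ℂ)}
    (hGS : ∀ k ∉ S, G k = 0) {k' : S} (hG : A G - z • G = c • delta (k' : ℤ)) (k : S) :
    entry (res (compress S A) z) k k' = G k / c := by
  have h1 : compress S A (restrict S G) - z • restrict S G = c • delta k' := by
    rw [compress_apply, extend_restrict hGS, ← map_smul, ← map_sub, hG, map_smul, restrict_delta]
  have h := res_eq hA h1
  rw [map_smul] at h
  rw [entry_eq, ← restrict_apply, ← h, lp.coeFn_smul, Pi.smul_apply, smul_eq_mul,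
    mul_div_cancel_left₀ _ hc]

theorem entry_res_opU_eq {α : ℤ → ℂ} (hα : ∀ k, ‖α k‖ ≤ 1) {z : ℂ} (hz0 : z ≠ 0) (hz : ‖z‖ ≠ 1)
    {a b u v : ℤ → ℂ} {k' m n : ℤ} (hab : ∀ k, k ≤ k' → BlockRel α z k a b)
    (huv : ∀ k, k' < k → BlockRel α z k u v) (ha : SqSummableOn (Set.Iic m) a)
    (hu : SqSummableOn (Set.Ici n) u) (hw : wronskian a b u v k' ≠ 0) (k : ℤ) :
    entry (res (opU α hα) z) k k' =
      greenCases k k' (a k * v k') (u k * b k') / (z * wronskian a b u v k') :=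
  entry_res_eq_div (isUnit_sub_of_mem_unitary (opU_mem_unitary α hα) hz)
    (mul_ne_zero hz0 hw)
    (opU_green hα hab huv ⟨_, memℓp_greenCases ha hu k' (v k') (b k')⟩ fun _ => rfl) k

theorem entry_res_compress_opU_eq {α : ℤ → ℂ} (hα : ∀ k, ‖α k‖ ≤ 1) {S : Set ℤ} [DecidableEq S]
    (hS : Decouples α S) {z : ℂ} (hz0 : z ≠ 0) (hz : ‖z‖ ≠ 1)
    {a b u v : ℤ → ℂ} {k' : S} {m n : ℤ} (hab : ∀ k, k ≤ (k' : ℤ) → BlockRel α z k a b)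
    (huv : ∀ k, (k' : ℤ) < k → BlockRel α z k u v) (ha : SqSummableOn (Set.Iic m) a)
    (hu : SqSummableOn (Set.Ici n) u) (hw : wronskian a b u v k' ≠ 0)
    (ha0 : ∀ k ∉ S, k < (k' : ℤ) → a k = 0) (hu0 : ∀ k ∉ S, (k' : ℤ) < k → u k = 0) (k : S) :
    entry (res (compress S (opU α hα)) z) k k' =
      greenCases k k' (a k * v k') (u k * b k') / (z * wronskian a b u v k') := by
  refine entry_res_compress_eq_div
    (isUnit_sub_of_mem_unitary (hS.compress_opU_mem_unitary hα) hz)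
    (mul_ne_zero hz0 hw) (G := ⟨_, memℓp_greenCases ha hu k' (v k') (b k')⟩) (fun j hj => ?_)
    (opU_green hα hab huv _ fun _ => rfl) k
  change greenCases j k' (a j * v k') (u j * b k') = 0
  have hj' : j ≠ k' := fun e => hj (e ▸ k'.2)
  rcases hj'.lt_or_gt with h | h
  · rw [greenCases_left (.inl h), ha0 j hj h, zero_mul]
  · rw [greenCases_right (.inl h), hu0 j hj h, zero_mul]

/-! ### Weyl solutions at a decoupling point -/

open Classical in
/-- The diagonal entry at `j` of the diagonal block `Θ_n`, for `j = n` and `j = n - 1`. -/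
def edgeCoeff (α : ℤ → ℂ) (n j : ℤ) : ℂ := if j = n then conj (α n) else -α n

/-- If `(U - z) g = δ_j`, where `j` belongs to a diagonal block `Θ_n`, then `g` gives rise to
square summable solutions of the block relations off `n`. -/
theorem exists_blockRel_of_sub_smul_eq_delta {α : ℤ → ℂ} (hα : ∀ k, ‖α k‖ ≤ 1) {z : ℂ}
    (hz : z ≠ 0) {n j : ℤ} (hn : rho α n = 0) (hj : j = n ∨ j = n - 1) {g : ℓ²(ℤ, ℂ)}
    (hg : opU α hα g - z • g = delta j) :
    ∃ u v : ℓ²(ℤ, ℂ), (∀ k ≠ n, BlockRel α z k u v) ∧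
      (Even n → u j = g j ∧ z * edgeCoeff α n j * v j = z * g j + 1) ∧
      (Odd n → u j = z * g j + 1 ∧ v j = edgeCoeff α n j * g j) := by
  have hU : ∀ k, opV α hα (opW α hα g) k = z * g k + if k = j then 1 else 0 := by
    intro k
    have := congrArg (fun f : ℓ²(ℤ, ℂ) => f k) (sub_eq_iff_eq_add.1 hg)
    simp only [lp.coeFn_add, lp.coeFn_smul, Pi.add_apply, Pi.smul_apply, smul_eq_mul,
      delta_apply] at this
    rw [← opU_apply, this, add_comm]
  have hWodd : ∀ k, Odd k → -α k * g (k - 1) + rho α k * g k = opW α hα g (k - 1) ∧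
      rho α k * g (k - 1) + conj (α k) * g k = opW α hα g k := by
    intro k hk
    have hk1 : ¬ Odd (k - 1) := Int.not_odd_iff_even.2 (hk.sub_odd odd_one)
    rw [opW_apply, opW_apply, if_neg hk1, if_pos hk, sub_add_cancel]
    exact ⟨rfl, rfl⟩
  have hVeven : ∀ (f : ℓ²(ℤ, ℂ)) k, Even k →
      -α k * f (k - 1) + rho α k * f k = opV α hα f (k - 1) ∧
      rho α k * f (k - 1) + conj (α k) * f k = opV α hα f k := by
    intro f k hk
    have hk1 : ¬ Even (k - 1) := Int.not_even_iff_odd.2 (hk.sub_odd odd_one)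
    rw [opV_apply, opV_apply, if_neg hk1, if_pos hk, sub_add_cancel]
    exact ⟨rfl, rfl⟩
  rcases Int.even_or_odd n with hne | hno
  · have hno : ¬ Odd n := Int.not_odd_iff_even.2 hne
    -- For even `n` the relation for `W` holds by definition of `v`, and the defect `δ_j` appears in
    -- the relation for `V`, within the block `n`.
    refine ⟨g, z⁻¹ • opW α hα g, fun k hk => ⟨fun ho => ?_, fun he => ?_⟩, fun _ => ⟨rfl, ?_⟩,
      fun h => absurd h hno⟩
    · simp only [lp.coeFn_smul, Pi.smul_apply, smul_eq_mul, mul_inv_cancel_left₀ hz]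
      exact hWodd k ho
    · have hkj : k ≠ j ∧ k - 1 ≠ j := by
        obtain ⟨x, hx⟩ := hne
        obtain ⟨y, hy⟩ := he
        omega
      obtain ⟨e1, e2⟩ := hVeven (opW α hα g) k he
      rw [hU, if_neg hkj.2, add_zero] at e1
      rw [hU, if_neg hkj.1, add_zero] at e2
      simp only [lp.coeFn_smul, Pi.smul_apply, smul_eq_mul]
      constructor <;> refine mul_left_cancel₀ hz ?_ <;> field_simp
      · linear_combination e1
      · linear_combination e2
    · obtain ⟨e1, e2⟩ := hVeven (opW α hα g) n hne
      rw [hU, hn, Complex.ofReal_zero] at e1 e2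
      simp only [lp.coeFn_smul, Pi.smul_apply, smul_eq_mul]
      rw [mul_assoc, mul_left_comm _ z⁻¹, mul_inv_cancel_left₀ hz, edgeCoeff]
      rcases hj with rfl | rfl
      · rw [if_pos rfl] at e2 ⊢
        linear_combination e2
      · rw [if_pos rfl] at e1
        rw [if_neg (by omega)]
        linear_combination e1
  · have hne : ¬ Even n := Int.not_even_iff_odd.2 hno
    have hu : ∀ k, (z • g + delta j : ℓ²(ℤ, ℂ)) k = opV α hα (opW α hα g) k := by
      intro k
      simp only [lp.coeFn_add, lp.coeFn_smul, Pi.add_apply, Pi.smul_apply, smul_eq_mul,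
        delta_apply, hU]
    -- For odd `n` take `u = U g` instead: now the relation for `V` is exact and the defect `W δ_j`
    -- appears in the relation for `W`, again within the block `n`.
    refine ⟨z • g + delta j, opW α hα g, fun k hk => ⟨fun ho => ?_, fun he => ?_⟩,
      fun h => absurd h hne, fun _ => ⟨by rw [hu, hU, if_pos rfl], ?_⟩⟩
    · have hkj : k ≠ j ∧ k - 1 ≠ j := by
        obtain ⟨x, hx⟩ := hno
        obtain ⟨y, hy⟩ := ho
        omega
      obtain ⟨e1, e2⟩ := hWodd k ho
      rw [hu, hu, hU, hU, if_neg hkj.1, if_neg hkj.2]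
      constructor
      · linear_combination z * e1
      · linear_combination z * e2
    · rw [hu, hu]
      exact hVeven _ k he
    · obtain ⟨e1, e2⟩ := hWodd n hno
      rw [hn, Complex.ofReal_zero] at e1 e2
      rw [edgeCoeff]
      rcases hj with rfl | rfl
      · rw [if_pos rfl]
        linear_combination -e2
      · rw [if_neg (by omega)]
        linear_combination -e1

/-! ### The phase `gam` and the edge entries -/

theorem conj_gam_mul_gam (t : ℝ) : conj (gam t) * gam t = 1 := by
  rw [gam, ← Complex.exp_conj, ← Complex.exp_add, ← Complex.exp_zero]
  congr 1
  simp [Complex.conj_ofNat]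
  ring

theorem gam_ne_zero (t : ℝ) : gam t ≠ 0 := Complex.exp_ne_zero _

theorem conj_gam_sq (t : ℝ) : conj (gam t) ^ 2 = Complex.exp (Complex.I * t) := by
  rw [gam, ← Complex.exp_conj, ← Complex.exp_nat_mul]
  congr 1
  simp [Complex.conj_ofNat]
  ring

theorem conj_gam_ne_zero (t : ℝ) : conj (gam t) ≠ 0 := by
  simpa using gam_ne_zero t

theorem edgeCoeff_self (α : ℤ → ℂ) (t : ℝ) (k₀ : ℤ) :
    edgeCoeff (setCoeff α k₀ t) k₀ k₀ = gam t ^ 2 := by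
  rw [edgeCoeff, if_pos rfl, setCoeff_self, ← conj_gam_sq, map_pow, Complex.conj_conj]

theorem edgeCoeff_add_one (α : ℤ → ℂ) (t : ℝ) (k₀ : ℤ) :
    edgeCoeff (setCoeff α (k₀ + 1) t) (k₀ + 1) k₀ = -conj (gam t) ^ 2 := by
  rw [edgeCoeff, if_neg (by omega), setCoeff_self, ← conj_gam_sq]

/-! ### The solutions `p±, q±, r±, s±` -/

section Solutions

variable {α : ℤ → ℂ} {t : ℝ} {z : ℂ} {k₀ : ℤ}

theorem blockRel_plus_pr (hα : ∀ k, ‖α k‖ < 1) (hz : z ≠ 0) (k : ℤ) :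
    BlockRel α z k (pPlus α t z k₀) (rPlus α t z k₀) := blockRel_sol hα hz k₀ _ k

theorem blockRel_plus_qs (hα : ∀ k, ‖α k‖ < 1) (hz : z ≠ 0) (k : ℤ) :
    BlockRel α z k (qPlus α t z k₀) (sPlus α t z k₀) := blockRel_sol hα hz k₀ _ k

theorem blockRel_minus_pr (hα : ∀ k, ‖α k‖ < 1) (hz : z ≠ 0) (k : ℤ) :
    BlockRel α z k (pMinus α t z k₀) (rMinus α t z k₀) := blockRel_sol hα hz k₀ _ k

theorem blockRel_minus_qs (hα : ∀ k, ‖α k‖ < 1) (hz : z ≠ 0) (k : ℤ) :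
    BlockRel α z k (qMinus α t z k₀) (sMinus α t z k₀) := blockRel_sol hα hz k₀ _ k

theorem plus_self_of_odd (h : Odd k₀) :
    pPlus α t z k₀ k₀ = z * conj (gam t) ∧ rPlus α t z k₀ k₀ = gam t ∧
    qPlus α t z k₀ k₀ = z * conj (gam t) ∧ sPlus α t z k₀ k₀ = -gam t := by
  simp [pPlus, rPlus, qPlus, sPlus, solPRPlus, solQSPlus, sol_self, h]

theorem plus_self_of_even (h : Even k₀) :
    pPlus α t z k₀ k₀ = gam t ∧ rPlus α t z k₀ k₀ = conj (gam t) ∧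
    qPlus α t z k₀ k₀ = -gam t ∧ sPlus α t z k₀ k₀ = conj (gam t) := by
  have h' : ¬ Odd k₀ := Int.not_odd_iff_even.2 h
  simp only [pPlus, rPlus, qPlus, sPlus, solPRPlus, solQSPlus, sol_self, if_neg h']
  exact ⟨rfl, rfl, rfl, rfl⟩

theorem minus_self_of_odd (h : Odd k₀) :
    pMinus α t z k₀ k₀ = conj (gam t) ∧ rMinus α t z k₀ k₀ = -gam t ∧
    qMinus α t z k₀ k₀ = conj (gam t) ∧ sMinus α t z k₀ k₀ = gam t := by
  simp only [pMinus, rMinus, qMinus, sMinus, solPRMinus, solQSMinus, sol_self, if_pos h]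
  exact ⟨rfl, rfl, rfl, rfl⟩

theorem minus_self_of_even (h : Even k₀) :
    pMinus α t z k₀ k₀ = -z * gam t ∧ rMinus α t z k₀ k₀ = conj (gam t) ∧
    qMinus α t z k₀ k₀ = z * gam t ∧ sMinus α t z k₀ k₀ = conj (gam t) := by
  have h' : ¬ Odd k₀ := Int.not_odd_iff_even.2 h
  simp only [pMinus, rMinus, qMinus, sMinus, solPRMinus, solQSMinus, sol_self, if_neg h']
  exact ⟨rfl, rfl, rfl, rfl⟩

/-- If `(u, v)` satisfies the block relations at `1 / conj z`, then `(conj v, conj u)` satisfies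
them at `z`. -/
theorem BlockRel.conj (hα : ∀ k, ‖α k‖ ≤ 1) (hz : z ≠ 0) {k : ℤ} {u v : ℤ → ℂ}
    (h : BlockRel α (1 / conj z) k u v) :
    BlockRel α z k (fun k => conj (v k)) (fun k => conj (u k)) := by
  have hs := rho_sq hα k
  refine ⟨fun hk => ?_, fun hk => ?_⟩
  · obtain ⟨h1, h2⟩ := h.1 hk
    replace h1 := congrArg conj h1
    replace h2 := congrArg conj h2
    simp only [map_add, map_mul, map_neg, map_div₀, map_one, Complex.conj_conj,
      Complex.conj_ofReal] at h1 h2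
    field_simp at h1 h2
    constructor
    · linear_combination α k * h1 - rho α k * h2 + z * conj (u (k - 1)) * hs
    · linear_combination -rho α k * h1 - conj (α k) * h2 + z * conj (u k) * hs
  · obtain ⟨h1, h2⟩ := h.2 hk
    replace h1 := congrArg conj h1
    replace h2 := congrArg conj h2
    simp only [map_add, map_mul, map_neg, Complex.conj_conj, Complex.conj_ofReal] at h1 h2
    constructor
    · linear_combination α k * h1 - rho α k * h2 + conj (v (k - 1)) * hs
    · linear_combination -rho α k * h1 - conj (α k) * h2 + conj (v k) * hs

theorem conj_eq_of_blockRel (hα : ∀ k, ‖α k‖ < 1) (hz : z ≠ 0) {u v u' v' : ℤ → ℂ}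
    (h : ∀ k, BlockRel α z k u v) (h' : ∀ k, BlockRel α (1 / conj z) k u' v') {c : ℂ}
    (h0 : conj (v' k₀) = c * u k₀) (h1 : conj (u' k₀) = c * v k₀) (k : ℤ) :
    conj (u' k) = c * v k :=
  (eq_of_blockRel hα hz (fun k => (h' k).conj (fun k => (hα k).le) hz)
    (fun k => (h k).const_mul c) h0 h1 k).2

theorem zpow_neg_emod_of_even (h : Even k₀) : z ^ (-(k₀ % 2)) = 1 := by
  rw [Int.even_iff.1 h, neg_zero, zpow_zero]

theorem zpow_neg_emod_of_odd (h : Odd k₀) : z ^ (-(k₀ % 2)) = 1 / z := by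
  rw [Int.odd_iff.1 h, zpow_neg_one, one_div]

theorem one_div_conj_ne_zero (hz : z ≠ 0) : 1 / conj z ≠ 0 := by simpa using hz

/-- Conjugation at `1 / conj z` turns one solution into another with components exchanged, so
comparing both components at `k₀` suffices. The power of `z` is the ratio of the initial values. -/
theorem pPlus_conj (hα : ∀ k, ‖α k‖ < 1) (hz : z ≠ 0) (k : ℤ) :
    conj (pPlus α t (1 / conj z) k₀ k) = z ^ (-(k₀ % 2)) * rPlus α t z k₀ k := by
  refine conj_eq_of_blockRel (k₀ := k₀) hα hz (blockRel_plus_pr hα hz)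
    (blockRel_plus_pr hα (one_div_conj_ne_zero hz)) ?_ ?_ k <;>
  rcases Int.even_or_odd k₀ with h | h
  · obtain ⟨e1, e2, e3, e4⟩ := plus_self_of_even (α := α) (t := t) (z := z) h
    obtain ⟨f1, f2, f3, f4⟩ := plus_self_of_even (α := α) (t := t) (z := 1 / conj z) h
    rw [f2, e1, zpow_neg_emod_of_even h]; simp
  · obtain ⟨e1, e2, e3, e4⟩ := plus_self_of_odd (α := α) (t := t) (z := z) h
    obtain ⟨f1, f2, f3, f4⟩ := plus_self_of_odd (α := α) (t := t) (z := 1 / conj z) h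
    rw [f2, e1, zpow_neg_emod_of_odd h]; field_simp
  · obtain ⟨e1, e2, e3, e4⟩ := plus_self_of_even (α := α) (t := t) (z := z) h
    obtain ⟨f1, f2, f3, f4⟩ := plus_self_of_even (α := α) (t := t) (z := 1 / conj z) h
    rw [f1, e2, zpow_neg_emod_of_even h]; simp
  · obtain ⟨e1, e2, e3, e4⟩ := plus_self_of_odd (α := α) (t := t) (z := z) h
    obtain ⟨f1, f2, f3, f4⟩ := plus_self_of_odd (α := α) (t := t) (z := 1 / conj z) h
    rw [f1, e2, zpow_neg_emod_of_odd h]; simp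

theorem qPlus_conj (hα : ∀ k, ‖α k‖ < 1) (hz : z ≠ 0) (k : ℤ) :
    conj (qPlus α t (1 / conj z) k₀ k) = -z ^ (-(k₀ % 2)) * sPlus α t z k₀ k := by
  refine conj_eq_of_blockRel (k₀ := k₀) hα hz (blockRel_plus_qs hα hz)
    (blockRel_plus_qs hα (one_div_conj_ne_zero hz)) ?_ ?_ k <;>
  rcases Int.even_or_odd k₀ with h | h
  · obtain ⟨e1, e2, e3, e4⟩ := plus_self_of_even (α := α) (t := t) (z := z) h
    obtain ⟨f1, f2, f3, f4⟩ := plus_self_of_even (α := α) (t := t) (z := 1 / conj z) h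
    rw [f4, e3, zpow_neg_emod_of_even h]; simp
  · obtain ⟨e1, e2, e3, e4⟩ := plus_self_of_odd (α := α) (t := t) (z := z) h
    obtain ⟨f1, f2, f3, f4⟩ := plus_self_of_odd (α := α) (t := t) (z := 1 / conj z) h
    rw [f4, e3, zpow_neg_emod_of_odd h, map_neg]; field_simp
  · obtain ⟨e1, e2, e3, e4⟩ := plus_self_of_even (α := α) (t := t) (z := z) h
    obtain ⟨f1, f2, f3, f4⟩ := plus_self_of_even (α := α) (t := t) (z := 1 / conj z) h
    rw [f3, e4, zpow_neg_emod_of_even h]; simp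
  · obtain ⟨e1, e2, e3, e4⟩ := plus_self_of_odd (α := α) (t := t) (z := z) h
    obtain ⟨f1, f2, f3, f4⟩ := plus_self_of_odd (α := α) (t := t) (z := 1 / conj z) h
    rw [f3, e4, zpow_neg_emod_of_odd h]; simp

theorem pMinus_conj (hα : ∀ k, ‖α k‖ < 1) (hz : z ≠ 0) (k : ℤ) :
    conj (pMinus α t (1 / conj z) k₀ k) = -z ^ (-((k₀ + 1) % 2)) * rMinus α t z k₀ k := by
  refine conj_eq_of_blockRel (k₀ := k₀) hα hz (blockRel_minus_pr hα hz)
    (blockRel_minus_pr hα (one_div_conj_ne_zero hz)) ?_ ?_ k <;>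
  rcases Int.even_or_odd k₀ with h | h
  · obtain ⟨e1, e2, e3, e4⟩ := minus_self_of_even (α := α) (t := t) (z := z) h
    obtain ⟨f1, f2, f3, f4⟩ := minus_self_of_even (α := α) (t := t) (z := 1 / conj z) h
    rw [f2, e1, zpow_neg_emod_of_odd h.add_one, Complex.conj_conj]; field_simp
  · obtain ⟨e1, e2, e3, e4⟩ := minus_self_of_odd (α := α) (t := t) (z := z) h
    obtain ⟨f1, f2, f3, f4⟩ := minus_self_of_odd (α := α) (t := t) (z := 1 / conj z) h
    rw [f2, e1, zpow_neg_emod_of_even h.add_one]; simp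
  · obtain ⟨e1, e2, e3, e4⟩ := minus_self_of_even (α := α) (t := t) (z := z) h
    obtain ⟨f1, f2, f3, f4⟩ := minus_self_of_even (α := α) (t := t) (z := 1 / conj z) h
    rw [f1, e2, zpow_neg_emod_of_odd h.add_one]; simp
  · obtain ⟨e1, e2, e3, e4⟩ := minus_self_of_odd (α := α) (t := t) (z := z) h
    obtain ⟨f1, f2, f3, f4⟩ := minus_self_of_odd (α := α) (t := t) (z := 1 / conj z) h
    rw [f1, e2, zpow_neg_emod_of_even h.add_one]; simp

theorem qMinus_conj (hα : ∀ k, ‖α k‖ < 1) (hz : z ≠ 0) (k : ℤ) :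
    conj (qMinus α t (1 / conj z) k₀ k) = z ^ (-((k₀ + 1) % 2)) * sMinus α t z k₀ k := by
  refine conj_eq_of_blockRel (k₀ := k₀) hα hz (blockRel_minus_qs hα hz)
    (blockRel_minus_qs hα (one_div_conj_ne_zero hz)) ?_ ?_ k <;>
  rcases Int.even_or_odd k₀ with h | h
  · obtain ⟨e1, e2, e3, e4⟩ := minus_self_of_even (α := α) (t := t) (z := z) h
    obtain ⟨f1, f2, f3, f4⟩ := minus_self_of_even (α := α) (t := t) (z := 1 / conj z) h
    rw [f4, e3, zpow_neg_emod_of_odd h.add_one, Complex.conj_conj]; field_simp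
  · obtain ⟨e1, e2, e3, e4⟩ := minus_self_of_odd (α := α) (t := t) (z := z) h
    obtain ⟨f1, f2, f3, f4⟩ := minus_self_of_odd (α := α) (t := t) (z := 1 / conj z) h
    rw [f4, e3, zpow_neg_emod_of_even h.add_one]; simp
  · obtain ⟨e1, e2, e3, e4⟩ := minus_self_of_even (α := α) (t := t) (z := z) h
    obtain ⟨f1, f2, f3, f4⟩ := minus_self_of_even (α := α) (t := t) (z := 1 / conj z) h
    rw [f3, e4, zpow_neg_emod_of_odd h.add_one]; simp
  · obtain ⟨e1, e2, e3, e4⟩ := minus_self_of_odd (α := α) (t := t) (z := z) h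
    obtain ⟨f1, f2, f3, f4⟩ := minus_self_of_odd (α := α) (t := t) (z := 1 / conj z) h
    rw [f3, e4, zpow_neg_emod_of_even h.add_one]; simp

/-- `(p₊, r₊)`, extended by zero to the left of `k₀`, solves the decoupled block relations. -/
theorem blockRel_indicator_plus (hα : ∀ k, ‖α k‖ < 1) (hz : z ≠ 0) (k : ℤ) :
    BlockRel (setCoeff α k₀ t) z k ((Set.Ici k₀).indicator (pPlus α t z k₀))
      ((Set.Ici k₀).indicator (rPlus α t z k₀)) := by
  have hin : ∀ (f : ℤ → ℂ) {j}, k₀ ≤ j → (Set.Ici k₀).indicator f j = f j :=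
    fun f j hj => Set.indicator_of_mem (Set.mem_Ici.2 hj) f
  have hout : ∀ (f : ℤ → ℂ) {j}, j < k₀ → (Set.Ici k₀).indicator f j = 0 :=
    fun f j hj => Set.indicator_of_notMem (fun h => absurd (Set.mem_Ici.1 h) (by omega)) f
  rcases lt_trichotomy k k₀ with h | rfl | h
  · exact .of_eq_zero (hout _ (by omega)) (hout _ (by omega)) (hout _ h) (hout _ h)
  · have hg := conj_gam_mul_gam t
    have hc : conj (setCoeff α k t k) = gam t ^ 2 := by
      rw [setCoeff_self, ← conj_gam_sq, map_pow, Complex.conj_conj]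
    have hk1 : k - 1 < k := by omega
    -- Only the diagonal entry `conj (e^{it}) = γ²` of the edge block survives. It imposes a linear
    -- relation between `p₊(k₀)` and `r₊(k₀)`, which the prescribed initial values satisfy.
    rw [BlockRel, hout _ hk1, hout _ hk1, hin _ le_rfl, hin _ le_rfl, rho_setCoeff_self, hc]
    refine ⟨fun hk => ⟨by simp, ?_⟩, fun hk => ⟨by simp, ?_⟩⟩
    · obtain ⟨e1, e2, -, -⟩ := plus_self_of_odd (α := α) (t := t) (z := z) hk
      rw [e1, e2]
      linear_combination z * gam t * hg
    · obtain ⟨e1, e2, -, -⟩ := plus_self_of_even (α := α) (t := t) (z := z) hk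
      rw [e1, e2]
      linear_combination gam t * hg
  · exact ((blockRel_plus_pr hα hz k).congr_coeff (setCoeff_of_ne α t h.ne').symm).congr
      (hin _ (by omega)).symm (hin _ (by omega)).symm (hin _ (by omega)).symm
      (hin _ (by omega)).symm

/-- `(p₋, r₋)`, extended by zero to the right of `k₀`, solves the decoupled block relations. -/
theorem blockRel_indicator_minus (hα : ∀ k, ‖α k‖ < 1) (hz : z ≠ 0) (k : ℤ) :
    BlockRel (setCoeff α (k₀ + 1) t) z k ((Set.Iic k₀).indicator (pMinus α t z k₀))
      ((Set.Iic k₀).indicator (rMinus α t z k₀)) := by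
  have hin : ∀ (f : ℤ → ℂ) {j}, j ≤ k₀ → (Set.Iic k₀).indicator f j = f j :=
    fun f j hj => Set.indicator_of_mem (Set.mem_Iic.2 hj) f
  have hout : ∀ (f : ℤ → ℂ) {j}, k₀ < j → (Set.Iic k₀).indicator f j = 0 :=
    fun f j hj => Set.indicator_of_notMem (fun h => absurd (Set.mem_Iic.1 h) (by omega)) f
  rcases lt_trichotomy k (k₀ + 1) with h | rfl | h
  · exact ((blockRel_minus_pr hα hz k).congr_coeff (setCoeff_of_ne α t h.ne).symm).congr
      (hin _ (by omega)).symm (hin _ (by omega)).symm (hin _ (by omega)).symm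
      (hin _ (by omega)).symm
  · have hg := conj_gam_mul_gam t
    have hc : setCoeff α (k₀ + 1) t (k₀ + 1) = conj (gam t) ^ 2 := by
      rw [setCoeff_self, ← conj_gam_sq]
    have hk1 : k₀ < k₀ + 1 := by omega
    -- Here the surviving entry is the upper one, `-e^{it}`, of the block `k₀ + 1`, whose parity is
    -- opposite to that of `k₀`.
    rw [BlockRel, add_sub_cancel_right, hout _ hk1, hout _ hk1, hin _ le_rfl, hin _ le_rfl,
      rho_setCoeff_self, hc]
    refine ⟨fun hk => ⟨?_, by simp⟩, fun hk => ⟨?_, by simp⟩⟩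
    · have hk' : Even k₀ := by simpa using hk.sub_odd odd_one
      obtain ⟨e1, e2, -, -⟩ := minus_self_of_even (α := α) (t := t) (z := z) hk'
      rw [e1, e2]
      linear_combination z * conj (gam t) * hg
    · have hk' : Odd k₀ := by simpa using hk.sub_odd odd_one
      obtain ⟨e1, e2, -, -⟩ := minus_self_of_odd (α := α) (t := t) (z := z) hk'
      rw [e1, e2]
      linear_combination conj (gam t) * hg
  · exact .of_eq_zero (hout _ (by omega)) (hout _ (by omega)) (hout _ (by omega))
      (hout _ (by omega))

/-- A square summable solution of all block relations yields an eigenvector. -/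
theorem mul_eq_zero_of_blockRel (hα : ∀ k, ‖α k‖ ≤ 1) (hz : ‖z‖ ≠ 1) {a b : ℤ → ℂ}
    (hab : ∀ k, BlockRel α z k a b) (ha : Memℓp a 2) (j : ℤ) : b j * a j = 0 := by
  -- The factor `b j` makes `G` the glued function with the same solution on both sides, so that
  -- `opU_green` applies with a vanishing Wronskian.
  set G : ℓ²(ℤ, ℂ) := b j • ⟨a, ha⟩ with hGdef
  have hG : ∀ k, G k = b j * a k := fun k => rfl
  have h := opU_green hα (a := a) (b := b) (u := a) (v := b) (k' := j) (fun k _ => hab k)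
    (fun k _ => hab k) G (fun k => by rw [hG, greenCases, ite_self, mul_comm])
  have hw : wronskian a b a b j = 0 := by simp [wronskian]
  rw [hw, mul_zero, zero_smul, sub_eq_zero] at h
  have h0 := eq_zero_of_apply_eq_smul (isUnit_sub_of_mem_unitary (opU_mem_unitary α hα) hz) h
  rw [← hG, h0]
  rfl

/-- Otherwise `p₊` cut off at `k₀` would be an eigenvector of a decoupled unitary operator for `z`
off the circle. It is not zero, since `p₊(k₀) r₊(k₀) ≠ 0`. -/
theorem not_sqSummableOn_pPlus (hα : ∀ k, ‖α k‖ < 1) (hz0 : z ≠ 0) (hz : ‖z‖ ≠ 1) :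
    ¬ SqSummableOn (Set.Ici k₀) (pPlus α t z k₀) := by
  intro h
  have h1 := mul_eq_zero_of_blockRel (setCoeff_norm_le (fun k => (hα k).le) k₀ t) hz
    (blockRel_indicator_plus (k₀ := k₀) (t := t) hα hz0)
    ((h.congr fun k hk => (Set.indicator_of_mem hk _).symm).memℓp_of_support
      fun k hk => Set.indicator_of_notMem hk _) k₀
  rw [Set.indicator_of_mem Set.self_mem_Ici, Set.indicator_of_mem Set.self_mem_Ici] at h1
  rcases Int.even_or_odd k₀ with hk | hk
  · obtain ⟨e1, e2, -, -⟩ := plus_self_of_even (α := α) (t := t) (z := z) hk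
    rw [e1, e2, conj_gam_mul_gam] at h1
    exact one_ne_zero h1
  · obtain ⟨e1, e2, -, -⟩ := plus_self_of_odd (α := α) (t := t) (z := z) hk
    rw [e1, e2] at h1
    exact mul_ne_zero (gam_ne_zero t) (mul_ne_zero hz0 (conj_gam_ne_zero t)) h1

theorem not_sqSummableOn_pMinus (hα : ∀ k, ‖α k‖ < 1) (hz0 : z ≠ 0) (hz : ‖z‖ ≠ 1) :
    ¬ SqSummableOn (Set.Iic k₀) (pMinus α t z k₀) := by
  intro h
  have h1 := mul_eq_zero_of_blockRel (setCoeff_norm_le (fun k => (hα k).le) (k₀ + 1) t) hz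
    (blockRel_indicator_minus (k₀ := k₀) (t := t) hα hz0)
    ((h.congr fun k hk => (Set.indicator_of_mem hk _).symm).memℓp_of_support
      fun k hk => Set.indicator_of_notMem hk _) k₀
  rw [Set.indicator_of_mem Set.self_mem_Iic, Set.indicator_of_mem Set.self_mem_Iic] at h1
  rcases Int.even_or_odd k₀ with hk | hk
  · obtain ⟨e1, e2, -, -⟩ := minus_self_of_even (α := α) (t := t) (z := z) hk
    rw [e1, e2] at h1
    exact mul_ne_zero (conj_gam_ne_zero t) (mul_ne_zero (neg_ne_zero.2 hz0) (gam_ne_zero t)) h1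
  · obtain ⟨e1, e2, -, -⟩ := minus_self_of_odd (α := α) (t := t) (z := z) hk
    rw [e1, e2] at h1
    exact mul_ne_zero (neg_ne_zero.2 (gam_ne_zero t)) (conj_gam_ne_zero t) h1

/-- `p₋` is a combination of `p₊` and `q₊`. -/
theorem exists_pMinus_eq (hα : ∀ k, ‖α k‖ < 1) (hz : z ≠ 0) :
    ∃ c d : ℂ, ∀ k, c * pPlus α t z k₀ k + d * qPlus α t z k₀ k = pMinus α t z k₀ k := by
  rcases Int.even_or_odd k₀ with hk | hk
  · obtain ⟨e1, e2, e3, e4⟩ := plus_self_of_even (α := α) (t := t) (z := z) hk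
    obtain ⟨f1, f2, -, -⟩ := minus_self_of_even (α := α) (t := t) (z := z) hk
    refine ⟨(1 - z) / 2, (1 + z) / 2, fun k => (eq_of_blockRel (k₀ := k₀) hα hz
      (fun k => (blockRel_plus_pr hα hz k).linear_comb (blockRel_plus_qs hα hz k) _ _)
      (blockRel_minus_pr hα hz) ?_ ?_ k).1⟩
    · rw [e1, e3, f1]; ring
    · rw [e2, e4, f2]; ring
  · obtain ⟨e1, e2, e3, e4⟩ := plus_self_of_odd (α := α) (t := t) (z := z) hk
    obtain ⟨f1, f2, -, -⟩ := minus_self_of_odd (α := α) (t := t) (z := z) hk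
    refine ⟨(1 / z - 1) / 2, (1 / z + 1) / 2, fun k => (eq_of_blockRel (k₀ := k₀) hα hz
      (fun k => (blockRel_plus_pr hα hz k).linear_comb (blockRel_plus_qs hα hz k) _ _)
      (blockRel_minus_pr hα hz) ?_ ?_ k).1⟩
    · rw [e1, e3, f1]; field_simp; ring
    · rw [e2, e4, f2]; field_simp; ring

end Solutions

/-! ### The half-lattice Weyl solutions -/

section Weyl

variable {α : ℤ → ℂ} {t : ℝ} {z : ℂ} {k₀ : ℤ}

/-- The edge values become multiples of `m ± 1`, the form in which `q + m p` and `s + m r` appear at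
`k₀`. -/
theorem exists_blockRel_compress (hα : ∀ k, ‖α k‖ ≤ 1) {S : Set ℤ} [DecidableEq S]
    (hS : Decouples α S) (hz0 : z ≠ 0) (hz : ‖z‖ ≠ 1) {n : ℤ} (j : S) (hn : rho α n = 0)
    (hj : (j : ℤ) = n ∨ (j : ℤ) = n - 1) :
    ∃ u v : ℓ²(ℤ, ℂ), (∀ k ≠ n, BlockRel α z k u v) ∧
      (Even n → 2 * z * u j = mFun (compress S (opU α hα)) j z - 1 ∧
        2 * z * edgeCoeff α n j * v j = mFun (compress S (opU α hα)) j z + 1) ∧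
      (Odd n → 2 * u j = mFun (compress S (opU α hα)) j z + 1 ∧
        2 * z * v j = edgeCoeff α n j * (mFun (compress S (opU α hα)) j z - 1)) := by
  have hu := isUnit_sub_of_mem_unitary (hS.compress_opU_mem_unitary hα) hz
  have h1 := congrArg (extend S) (sub_smul_res_apply hu (delta j))
  rw [map_sub, map_smul, (hS.preservesSupport_opU hα).extend_compress, extend_delta] at h1
  have hm := mFun_eq hu j
  rw [entry_eq, ← extend_apply_of_mem S _ j.2] at hm
  obtain ⟨u, v, huv, he, ho⟩ := exists_blockRel_of_sub_smul_eq_delta hα hz0 hn hj h1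
  refine ⟨u, v, huv, fun h => ?_, fun h => ?_⟩
  · obtain ⟨e1, e2⟩ := he h
    rw [hm]
    exact ⟨by rw [e1]; ring, by linear_combination 2 * e2⟩
  · obtain ⟨e1, e2⟩ := ho h
    rw [hm]
    exact ⟨by rw [e1]; ring, by rw [e2]; ring⟩

theorem mPlus_eq_mFun (hα : ∀ k, ‖α k‖ ≤ 1) (z : ℂ) :
    mPlus α hα t z k₀ = mFun (opUPlus α hα t k₀) ⟨k₀, Set.self_mem_Ici⟩ z := rfl

theorem mMinus_eq_neg_mFun (hα : ∀ k, ‖α k‖ ≤ 1) (z : ℂ) :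
    mMinus α hα t z k₀ = -mFun (opUMinus α hα t k₀) ⟨k₀, Set.self_mem_Iic⟩ z := rfl

theorem blockRel_uSol (hα : ∀ k, ‖α k‖ < 1) (hz : z ≠ 0) (M : ℂ → ℂ) (k : ℤ) :
    BlockRel α z k (uSol α t M z k₀) (vSol α t M z k₀) := by
  have := (blockRel_plus_qs (k₀ := k₀) (t := t) hα hz k).linear_comb
    (blockRel_plus_pr (k₀ := k₀) (t := t) hα hz k) 1 (M z)
  simp only [one_mul] at this
  exact this

theorem blockRel_uHatPlus (hα : ∀ k, ‖α k‖ < 1) (hz : z ≠ 0) (k : ℤ) :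
    BlockRel α z k (uHatPlus α (fun k => (hα k).le) t z k₀)
      (vHatPlus α (fun k => (hα k).le) t z k₀) :=
  blockRel_uSol hα hz (fun z => mPlus α (fun k => (hα k).le) t z k₀) k

theorem blockRel_uHatMinus (hα : ∀ k, ‖α k‖ < 1) (hz : z ≠ 0) (k : ℤ) :
    BlockRel α z k (uHatMinus α (fun k => (hα k).le) t z k₀)
      (vHatMinus α (fun k => (hα k).le) t z k₀) := by
  have := (blockRel_minus_qs (k₀ := k₀) (t := t) hα hz k).linear_comb
    (blockRel_minus_pr (k₀ := k₀) (t := t) hα hz k) 1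
    (mMinus α (fun k => (hα k).le) t z k₀)
  simp only [one_mul] at this
  exact this

/-- Square summability is inherited from the resolvent vector of `δ_{k₀}`: a multiple of its
solution agrees with `(û₊, v̂₊)` at `k₀`, hence on all of `[k₀, ∞)`. -/
theorem sqSummableOn_hatPlus (hα : ∀ k, ‖α k‖ < 1) (hz0 : z ≠ 0) (hz : ‖z‖ ≠ 1) :
    SqSummableOn (Set.Ici k₀) (uHatPlus α (fun k => (hα k).le) t z k₀) ∧
      SqSummableOn (Set.Ici k₀) (vHatPlus α (fun k => (hα k).le) t z k₀) := by
  obtain ⟨u, v, huv, he, ho⟩ := exists_blockRel_compress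
    (setCoeff_norm_le (fun k => (hα k).le) k₀ t) (decouples_Ici α k₀ t) hz0 hz (n := k₀)
    ⟨k₀, Set.self_mem_Ici⟩ (rho_setCoeff_self α k₀ t) (.inl rfl)
  have hm : mFun (compress (Set.Ici k₀) (opU (setCoeff α k₀ t)
      (setCoeff_norm_le (fun k => (hα k).le) k₀ t))) ⟨k₀, Set.self_mem_Ici⟩ z =
      mPlus α (fun k => (hα k).le) t z k₀ := rfl
  rw [hm, edgeCoeff_self] at he ho
  have hg := conj_gam_mul_gam t
  have key : ∃ c : ℂ, c * u k₀ = uHatPlus α (fun k => (hα k).le) t z k₀ k₀ ∧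
      c * v k₀ = vHatPlus α (fun k => (hα k).le) t z k₀ k₀ := by
    rcases Int.even_or_odd k₀ with hk | hk
    · obtain ⟨e1, e2, e3, e4⟩ := plus_self_of_even (α := α) (t := t) (z := z) hk
      obtain ⟨f1, f2⟩ := he hk
      refine ⟨2 * z * gam t, ?_, ?_⟩
      · rw [uHatPlus, e1, e3]
        linear_combination gam t * f1
      · rw [vHatPlus, e2, e4]
        linear_combination conj (gam t) * f2 - 2 * z * gam t * v k₀ * hg
    · obtain ⟨e1, e2, e3, e4⟩ := plus_self_of_odd (α := α) (t := t) (z := z) hk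
      obtain ⟨f1, f2⟩ := ho hk
      refine ⟨2 * z * conj (gam t), ?_, ?_⟩
      · rw [uHatPlus, e1, e3]
        linear_combination z * conj (gam t) * f1
      · rw [vHatPlus, e2, e4]
        linear_combination conj (gam t) * f2 +
          gam t * (mPlus α (fun k => (hα k).le) t z k₀ - 1) * hg
  obtain ⟨c, h1, h2⟩ := key
  have h := eq_of_blockRel_right hα hz0
    (fun k hk => ((huv k hk.ne').congr_coeff (setCoeff_of_ne α t hk.ne')).const_mul c)
    (fun k _ => blockRel_uHatPlus (k₀ := k₀) (t := t) hα hz0 k) h1 h2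
  exact ⟨((sqSummableOn_coe _ u).const_mul c).congr fun k hk => (h k hk).1,
    ((sqSummableOn_coe _ v).const_mul c).congr fun k hk => (h k hk).2⟩

theorem sqSummableOn_hatMinus (hα : ∀ k, ‖α k‖ < 1) (hz0 : z ≠ 0) (hz : ‖z‖ ≠ 1) :
    SqSummableOn (Set.Iic k₀) (uHatMinus α (fun k => (hα k).le) t z k₀) ∧
      SqSummableOn (Set.Iic k₀) (vHatMinus α (fun k => (hα k).le) t z k₀) := by
  obtain ⟨u, v, huv, he, ho⟩ := exists_blockRel_compress
    (setCoeff_norm_le (fun k => (hα k).le) (k₀ + 1) t) (decouples_Iic α k₀ t) hz0 hz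
    (n := k₀ + 1) ⟨k₀, Set.self_mem_Iic⟩ (rho_setCoeff_self α (k₀ + 1) t)
    (.inr (by simp))
  have hm : mFun (compress (Set.Iic k₀) (opU (setCoeff α (k₀ + 1) t)
      (setCoeff_norm_le (fun k => (hα k).le) (k₀ + 1) t))) ⟨k₀, Set.self_mem_Iic⟩ z =
      -mMinus α (fun k => (hα k).le) t z k₀ := (neg_neg _).symm
  rw [hm, edgeCoeff_add_one] at he ho
  have hg := conj_gam_mul_gam t
  have key : ∃ c : ℂ, c * u k₀ = uHatMinus α (fun k => (hα k).le) t z k₀ k₀ ∧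
      c * v k₀ = vHatMinus α (fun k => (hα k).le) t z k₀ k₀ := by
    rcases Int.even_or_odd k₀ with hk | hk
    · obtain ⟨e1, e2, e3, e4⟩ := minus_self_of_even (α := α) (t := t) (z := z) hk
      -- The edge block is `k₀ + 1`, so an even `k₀` falls under the odd case, and conversely.
      obtain ⟨f1, f2⟩ := ho hk.add_one
      refine ⟨2 * z * gam t, ?_, ?_⟩
      · rw [uHatMinus, e1, e3]
        linear_combination z * gam t * f1
      · rw [vHatMinus, e2, e4]
        linear_combination gam t * f2 +
          conj (gam t) * (mMinus α (fun k => (hα k).le) t z k₀ + 1) * hg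
    · obtain ⟨e1, e2, e3, e4⟩ := minus_self_of_odd (α := α) (t := t) (z := z) hk
      obtain ⟨f1, f2⟩ := he hk.add_one
      refine ⟨-2 * z * conj (gam t), ?_, ?_⟩
      · rw [uHatMinus, e1, e3]
        linear_combination -conj (gam t) * f1
      · rw [vHatMinus, e2, e4]
        linear_combination gam t * f2 + 2 * z * conj (gam t) * v k₀ * hg
  obtain ⟨c, h1, h2⟩ := key
  have h := eq_of_blockRel_left hα hz0
    (fun k hk => ((huv k (by omega)).congr_coeff (setCoeff_of_ne α t (by omega))).const_mul c)
    (fun k _ => blockRel_uHatMinus (k₀ := k₀) (t := t) hα hz0 k) h1 h2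
  exact ⟨((sqSummableOn_coe _ u).const_mul c).congr fun k hk => (h k hk).1,
    ((sqSummableOn_coe _ v).const_mul c).congr fun k hk => (h k hk).2⟩

/-! ### Green's functions of the half-lattice operators -/

theorem mPlus_conj (hα : ∀ k, ‖α k‖ ≤ 1) (hz0 : z ≠ 0) (hz : ‖z‖ ≠ 1) :
    conj (mPlus α hα t (1 / conj z) k₀) = -mPlus α hα t z k₀ :=
  mFun_conj (opUPlus_mem_unitary α hα t k₀) _ hz0 hz

theorem mMinus_conj (hα : ∀ k, ‖α k‖ ≤ 1) (hz0 : z ≠ 0) (hz : ‖z‖ ≠ 1) :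
    conj (mMinus α hα t (1 / conj z) k₀) = -mMinus α hα t z k₀ := by
  rw [mMinus_eq_neg_mFun, mMinus_eq_neg_mFun, map_neg,
    mFun_conj (opUMinus_mem_unitary α hα t k₀) _ hz0 hz]

/-- The sign picked up by `q₊` and the sign picked up by `M` are the same, so the combination `q₊ +
M p₊` is carried to a multiple of `s₊ + M r₊`. -/
theorem uSol_conj (hα : ∀ k, ‖α k‖ < 1) (hz : z ≠ 0) {M : ℂ → ℂ}
    (hM : conj (M (1 / conj z)) = -M z) (k : ℤ) :
    conj (uSol α t M (1 / conj z) k₀ k) = -z ^ (-(k₀ % 2)) * vSol α t M z k₀ k := by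
  rw [uSol, vSol, map_add, map_mul, pPlus_conj hα hz, qPlus_conj hα hz, hM]
  ring

theorem uHatPlus_conj (hα : ∀ k, ‖α k‖ < 1) (hz0 : z ≠ 0) (hz : ‖z‖ ≠ 1) (k : ℤ) :
    conj (uHatPlus α (fun k => (hα k).le) t (1 / conj z) k₀ k) =
      -z ^ (-(k₀ % 2)) * vHatPlus α (fun k => (hα k).le) t z k₀ k :=
  uSol_conj hα hz0 (M := fun z => mPlus α (fun k => (hα k).le) t z k₀)
    (mPlus_conj (fun k => (hα k).le) hz0 hz) k

theorem uHatMinus_conj (hα : ∀ k, ‖α k‖ < 1) (hz0 : z ≠ 0) (hz : ‖z‖ ≠ 1) (k : ℤ) :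
    conj (uHatMinus α (fun k => (hα k).le) t (1 / conj z) k₀ k) =
      z ^ (-((k₀ + 1) % 2)) * vHatMinus α (fun k => (hα k).le) t z k₀ k := by
  rw [uHatMinus, vHatMinus, map_add, map_mul, pMinus_conj hα hz0, qMinus_conj hα hz0,
    mMinus_conj _ hz0 hz]
  ring

theorem greenPlus'_eq (hα : ∀ k, ‖α k‖ < 1) (hz0 : z ≠ 0) (hz : ‖z‖ ≠ 1) (k k' : ℤ) :
    greenPlus' α (fun k => (hα k).le) t k₀ k k' z =
      greenPlus α (fun k => (hα k).le) t k₀ k k' z := by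
  rw [greenPlus', greenPlus, uHatPlus_conj hα hz0 hz, pPlus_conj hα hz0, mul_greenCases,
    mul_greenCases]
  congr 1 <;> ring

theorem greenMinus'_eq (hα : ∀ k, ‖α k‖ < 1) (hz0 : z ≠ 0) (hz : ‖z‖ ≠ 1) (k k' : ℤ) :
    greenMinus' α (fun k => (hα k).le) t k₀ k k' z =
      greenMinus α (fun k => (hα k).le) t k₀ k k' z := by
  rw [greenMinus', greenMinus, uHatMinus_conj hα hz0 hz, pMinus_conj hα hz0, mul_greenCases,
    mul_greenCases]
  congr 1 <;> ring

/-- The `m`-function drops out because `(p₊, r₊)` has zero Wronskian with itself. The value at `k₀`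
is the source of the factor `1/2` and of the power of `z` in the Green's function. -/
theorem wronskian_hatPlus (hα : ∀ k, ‖α k‖ < 1) (hz : z ≠ 0) {k' : ℤ} (hk' : k₀ ≤ k') :
    z ^ (-(k₀ % 2)) * wronskian (pPlus α t z k₀) (rPlus α t z k₀)
      (uHatPlus α (fun k => (hα k).le) t z k₀) (vHatPlus α (fun k => (hα k).le) t z k₀) k' =
      2 := by
  rw [wronskian_eq hz hk' (fun k _ _ => blockRel_plus_pr hα hz k)
    (fun k _ _ => blockRel_uHatPlus hα hz k)]
  have hg := conj_gam_mul_gam t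
  rcases Int.even_or_odd k₀ with h | h
  · obtain ⟨e1, e2, e3, e4⟩ := plus_self_of_even (α := α) (t := t) (z := z) h
    rw [wronskian_of_even h, zpow_neg_emod_of_even h, uHatPlus, vHatPlus, e1, e2, e3, e4]
    linear_combination 2 * hg
  · obtain ⟨e1, e2, e3, e4⟩ := plus_self_of_odd (α := α) (t := t) (z := z) h
    rw [wronskian_of_odd h, zpow_neg_emod_of_odd h, uHatPlus, vHatPlus, e1, e2, e3, e4]
    field_simp
    linear_combination 2 * hg

theorem wronskian_hatMinus (hα : ∀ k, ‖α k‖ < 1) (hz : z ≠ 0) {k' : ℤ} (hk' : k' ≤ k₀) :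
    z ^ (-((k₀ + 1) % 2)) * wronskian (uHatMinus α (fun k => (hα k).le) t z k₀)
      (vHatMinus α (fun k => (hα k).le) t z k₀) (pMinus α t z k₀) (rMinus α t z k₀) k' = 2 := by
  rw [← wronskian_eq hz hk' (fun k _ _ => blockRel_uHatMinus hα hz k)
    (fun k _ _ => blockRel_minus_pr hα hz k)]
  have hg := conj_gam_mul_gam t
  rcases Int.even_or_odd k₀ with h | h
  · obtain ⟨e1, e2, e3, e4⟩ := minus_self_of_even (α := α) (t := t) (z := z) h
    rw [wronskian_of_even h, zpow_neg_emod_of_odd h.add_one, uHatMinus, vHatMinus, e1, e2, e3, e4]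
    field_simp
    linear_combination 2 * hg
  · obtain ⟨e1, e2, e3, e4⟩ := minus_self_of_odd (α := α) (t := t) (z := z) h
    rw [wronskian_of_odd h, zpow_neg_emod_of_even h.add_one, uHatMinus, vHatMinus, e1, e2, e3, e4]
    linear_combination 2 * hg

theorem ne_zero_of_mul_eq_two {c w : ℂ} (h : c * w = 2) : w ≠ 0 := by
  rintro rfl
  simp at h

theorem div_eq_of_mul_eq_two (hz : z ≠ 0) {c w : ℂ} (h : c * w = 2) (x : ℂ) :
    x / (z * w) = c / (2 * z) * x := by
  have hw := ne_zero_of_mul_eq_two h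
  field_simp
  linear_combination -x * h

theorem entry_res_opUPlus_eq (hα : ∀ k, ‖α k‖ < 1) (hz0 : z ≠ 0) (hz : ‖z‖ ≠ 1)
    (k k' : Set.Ici k₀) :
    entry (res (opUPlus α (fun k => (hα k).le) t k₀) z) k k' =
      greenPlus α (fun k => (hα k).le) t k₀ k k' z := by
  have hw := wronskian_hatPlus (t := t) hα hz0 k'.2
  have hin : ∀ (f : ℤ → ℂ) (j : Set.Ici k₀), (Set.Ici k₀).indicator f j = f j :=
    fun f j => Set.indicator_of_mem j.2 f
  have hw' : wronskian ((Set.Ici k₀).indicator (pPlus α t z k₀))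
      ((Set.Ici k₀).indicator (rPlus α t z k₀)) (uHatPlus α (fun k => (hα k).le) t z k₀)
      (vHatPlus α (fun k => (hα k).le) t z k₀) k' = wronskian (pPlus α t z k₀) (rPlus α t z k₀)
      (uHatPlus α (fun k => (hα k).le) t z k₀) (vHatPlus α (fun k => (hα k).le) t z k₀) k' := by
    rw [wronskian, wronskian, hin, hin]
  -- The left solution is the truncated `p₊`, zero on `(-∞, k₀ - 1]`. Relations for `û₊` are
  -- required only for `k > k' ≥ k₀`, where the modified coefficients equal `α`; this is why it
  -- needs no truncation.
  have h := entry_res_compress_opU_eq (setCoeff_norm_le (fun k => (hα k).le) k₀ t)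
    (decouples_Ici α k₀ t) hz0 hz (k' := k') (m := k₀ - 1) (n := k₀)
    (fun k _ => blockRel_indicator_plus hα hz0 k)
    (fun k hk => (blockRel_uHatPlus (t := t) (k₀ := k₀) hα hz0 k).congr_coeff
      (setCoeff_of_ne α t (lt_of_le_of_lt k'.2 hk).ne').symm)
    (sqSummableOn_of_eq_zero fun k hk => Set.indicator_of_notMem
      (fun h => by rw [Set.mem_Iic] at hk; rw [Set.mem_Ici] at h; omega) _)
    (sqSummableOn_hatPlus hα hz0 hz).1 (by rw [hw']; exact ne_zero_of_mul_eq_two hw)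
    (fun k hk _ => Set.indicator_of_notMem hk _)
    (fun k hk hk' => absurd (Set.mem_Ici.2 ((Set.mem_Ici.1 k'.2).trans hk'.le)) hk) k
  rw [hw', hin, hin, div_eq_of_mul_eq_two hz0 hw] at h
  exact h

theorem entry_res_opUMinus_eq (hα : ∀ k, ‖α k‖ < 1) (hz0 : z ≠ 0) (hz : ‖z‖ ≠ 1)
    (k k' : Set.Iic k₀) :
    entry (res (opUMinus α (fun k => (hα k).le) t k₀) z) k k' =
      greenMinus α (fun k => (hα k).le) t k₀ k k' z := by
  have hw := wronskian_hatMinus (t := t) hα hz0 k'.2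
  have hin : ∀ (f : ℤ → ℂ) (j : Set.Iic k₀), (Set.Iic k₀).indicator f j = f j :=
    fun f j => Set.indicator_of_mem j.2 f
  have hw' : wronskian (uHatMinus α (fun k => (hα k).le) t z k₀)
      (vHatMinus α (fun k => (hα k).le) t z k₀) ((Set.Iic k₀).indicator (pMinus α t z k₀))
      ((Set.Iic k₀).indicator (rMinus α t z k₀)) k' =
      wronskian (uHatMinus α (fun k => (hα k).le) t z k₀)
      (vHatMinus α (fun k => (hα k).le) t z k₀) (pMinus α t z k₀) (rMinus α t z k₀) k' := by
    rw [wronskian, wronskian, hin, hin]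
  have h := entry_res_compress_opU_eq (setCoeff_norm_le (fun k => (hα k).le) (k₀ + 1) t)
    (decouples_Iic α k₀ t) hz0 hz (k' := k') (m := k₀) (n := k₀ + 1)
    (fun k hk => (blockRel_uHatMinus (t := t) (k₀ := k₀) hα hz0 k).congr_coeff
      (setCoeff_of_ne α t (Int.lt_add_one_of_le (hk.trans k'.2)).ne).symm)
    (fun k _ => blockRel_indicator_minus hα hz0 k)
    (sqSummableOn_hatMinus hα hz0 hz).1
    (sqSummableOn_of_eq_zero fun k hk => Set.indicator_of_notMem
      (fun h => by rw [Set.mem_Ici] at hk; rw [Set.mem_Iic] at h; omega) _)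
    (by rw [hw']; exact ne_zero_of_mul_eq_two hw)
    (fun k hk hk' => absurd (Set.mem_Iic.2 (hk'.le.trans (Set.mem_Iic.1 k'.2))) hk)
    (fun k hk _ => Set.indicator_of_notMem hk _) k
  rw [hw', hin, hin, div_eq_of_mul_eq_two hz0 hw] at h
  exact h

end Weyl

/-! ### The Weyl–Titchmarsh functions `M±` -/

section FullLattice

variable {α : ℤ → ℂ} {t : ℝ} {z : ℂ} {k₀ : ℤ}

/-- The numerator of `M₋`, where `a = α_{k₀} γ²` and `m = m₋(z, k₀ - 1)`. -/
def weylNum (a m : ℂ) : ℂ := 2 + a + conj a - (a - conj a) * m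

/-- The denominator of `M₋`, where `a = α_{k₀} γ²` and `m = m₋(z, k₀ - 1)`. -/
def weylDen (a m : ℂ) : ℂ := a - conj a + (2 - a - conj a) * m

theorem weylDen_re (a m : ℂ) : (weylDen a m).re = (2 - 2 * a.re) * m.re := by
  simp [weylDen, -mul_eq_mul_right_iff]
  ring

/-- This identity makes the map `m ↦ M₋` preserve the sign of the real part when `|a| < 1`. -/
theorem weylNum_mul_conj_weylDen_re (a m : ℂ) :
    (weylNum a m * conj (weylDen a m)).re = 4 * (1 - ‖a‖ ^ 2) * m.re := by
  rw [← Complex.normSq_eq_norm_sq, Complex.normSq_apply]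
  simp [weylNum, weylDen]
  ring

theorem weylDen_ne_zero {a m : ℂ} (ha : ‖a‖ < 1) (hm : m.re ≠ 0) : weylDen a m ≠ 0 := by
  intro h
  have h1 := weylDen_re a m
  rw [h, Complex.zero_re] at h1
  have h2 := Complex.re_le_norm a
  exact mul_ne_zero (by linarith) hm h1.symm

theorem weyl_div_re {a m : ℂ} :
    (weylNum a m / weylDen a m).re =
      4 * (1 - ‖a‖ ^ 2) * m.re / Complex.normSq (weylDen a m) := by
  rw [← weylNum_mul_conj_weylDen_re, div_eq_mul_inv, Complex.inv_def, ← mul_assoc,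
    Complex.re_mul_ofReal, div_eq_mul_inv]

theorem conj_weylNum (a m : ℂ) : conj (weylNum a m) = weylNum a (-conj m) := by
  simp [weylNum, Complex.conj_ofNat]
  ring

theorem conj_weylDen (a m : ℂ) : conj (weylDen a m) = -weylDen a (-conj m) := by
  simp [weylDen, Complex.conj_ofNat]
  ring

/-- The full-lattice Weyl–Titchmarsh function `M₋(z, k₀)` in terms of `m₋(z, k₀ - 1)`. -/
def weylMinus (α : ℤ → ℂ) (hα : ∀ k, ‖α k‖ ≤ 1) (t : ℝ) (k₀ : ℤ) (z : ℂ) : ℂ :=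
  weylNum (α k₀ * gam t ^ 2) (mMinus α hα t z (k₀ - 1)) /
    weylDen (α k₀ * gam t ^ 2) (mMinus α hα t z (k₀ - 1))

theorem norm_gam (t : ℝ) : ‖gam t‖ = 1 := by
  have h := congrArg norm (conj_gam_mul_gam t)
  rw [norm_mul, Complex.norm_conj, norm_one] at h
  nlinarith [norm_nonneg (gam t)]

theorem norm_mul_gam_sq_lt (hα : ∀ k, ‖α k‖ < 1) (k : ℤ) : ‖α k * gam t ^ 2‖ < 1 := by
  simpa [norm_gam] using hα k

theorem mMinus_re_ne_zero (hα : ∀ k, ‖α k‖ ≤ 1) (hz : ‖z‖ ≠ 1) :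
    (mMinus α hα t z k₀).re ≠ 0 := by
  have hU := opUMinus_mem_unitary α hα t k₀
  rw [mMinus_eq_neg_mFun, Complex.neg_re, neg_ne_zero]
  rcases hz.lt_or_gt with h | h
  · exact (mFun_re_pos hU _ h).ne'
  · exact (mFun_re_neg hU _ h).ne

theorem weylDen_mMinus_ne_zero (hα : ∀ k, ‖α k‖ < 1) (hz : ‖z‖ ≠ 1) :
    weylDen (α k₀ * gam t ^ 2) (mMinus α (fun k => (hα k).le) t z (k₀ - 1)) ≠ 0 :=
  weylDen_ne_zero (norm_mul_gam_sq_lt hα k₀) (mMinus_re_ne_zero _ hz)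

theorem isCaratheodory_mPlus (hα : ∀ k, ‖α k‖ ≤ 1) :
    IsCaratheodory (fun z => mPlus α hα t z k₀) :=
  isCaratheodory_mFun (opUPlus_mem_unitary α hα t k₀) _

theorem weylMinus_conj (hα : ∀ k, ‖α k‖ ≤ 1) (hz0 : z ≠ 0) (hz : ‖z‖ ≠ 1) :
    conj (weylMinus α hα t k₀ (1 / conj z)) = -weylMinus α hα t k₀ z := by
  rw [weylMinus, weylMinus, map_div₀, conj_weylNum, conj_weylDen, mMinus_conj hα hz0 hz, neg_neg,
    div_neg]

theorem isAntiCaratheodory_weylMinus (hα : ∀ k, ‖α k‖ < 1) :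
    IsAntiCaratheodory (weylMinus α (fun k => (hα k).le) t k₀) := by
  have hU := opUMinus_mem_unitary α (fun k => (hα k).le) t (k₀ - 1)
  refine ⟨fun z hz => ?_, fun z hz => ?_, fun z hz => ?_⟩
  · have hz' : ‖z‖ ≠ 1 := (mem_ball_zero_iff.1 hz).ne
    have hm : AnalyticAt ℂ (fun z => mMinus α (fun k => (hα k).le) t z (k₀ - 1)) z :=
      (analyticAt_mFun hU _ hz').neg
    have hD := weylDen_mMinus_ne_zero (k₀ := k₀) (t := t) hα hz'
    have h1 : AnalyticAt ℂ (fun z => weylNum (α k₀ * gam t ^ 2)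
        (mMinus α (fun k => (hα k).le) t z (k₀ - 1))) z := by
      unfold weylNum; fun_prop
    have h2 : AnalyticAt ℂ (fun z => weylDen (α k₀ * gam t ^ 2)
        (mMinus α (fun k => (hα k).le) t z (k₀ - 1))) z := by
      unfold weylDen; fun_prop
    exact (h1.fun_div h2 hD).fun_neg
  · have hm : (mMinus α (fun k => (hα k).le) t z (k₀ - 1)).re < 0 := by
      rw [mMinus_eq_neg_mFun, Complex.neg_re, neg_lt_zero]
      exact mFun_re_pos hU _ hz
    have ha := norm_mul_gam_sq_lt (t := t) hα k₀
    have ha' : 0 < 1 - ‖α k₀ * gam t ^ 2‖ ^ 2 := by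
      nlinarith [norm_nonneg (α k₀ * gam t ^ 2)]
    rw [Complex.neg_re, weylMinus, weyl_div_re, neg_nonneg]
    refine div_nonpos_of_nonpos_of_nonneg ?_ (Complex.normSq_nonneg _)
    nlinarith
  · rw [map_neg, weylMinus_conj _ (norm_pos_iff.1 (by linarith)) hz.ne']
    ring

/-- Inside the disk `Re m₊ > 0 ≥ Re M₋`; outside, reflection reverses both signs. Strictness is
needed for `m₊` only. -/
theorem mPlus_sub_weylMinus_ne_zero (hα : ∀ k, ‖α k‖ < 1) (hz : ‖z‖ ≠ 1) :
    mPlus α (fun k => (hα k).le) t z k₀ - weylMinus α (fun k => (hα k).le) t k₀ z ≠ 0 := by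
  have hU := opUPlus_mem_unitary α (fun k => (hα k).le) t k₀
  have hC := isAntiCaratheodory_weylMinus (t := t) (k₀ := k₀) hα
  intro h
  replace h := congrArg Complex.re h
  rw [Complex.sub_re, Complex.zero_re, mPlus_eq_mFun] at h
  rcases hz.lt_or_gt with h1 | h1
  · have h2 := mFun_re_pos hU ⟨k₀, Set.self_mem_Ici⟩ h1
    have h3 := hC.2.1 z h1
    rw [Complex.neg_re] at h3
    linarith
  · have h2 := mFun_re_neg hU ⟨k₀, Set.self_mem_Ici⟩ h1
    have h3 := hC.2.1 (1 / conj z) (by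
      rw [norm_one_div_conj, div_lt_one (by linarith)]; exact h1)
    have h4 := congrArg Complex.re
      (weylMinus_conj (t := t) (k₀ := k₀) (fun k => (hα k).le)
        (norm_pos_iff.1 (by linarith)) hz)
    rw [Complex.conj_re, Complex.neg_re] at h4
    rw [Complex.neg_re] at h3
    linarith

/-- The full-lattice Weyl solution at `-∞` is a multiple of `û₋(z, ·, k₀ - 1)`. -/
theorem uSol_weylMinus_eq (hα : ∀ k, ‖α k‖ < 1) (hz0 : z ≠ 0) (hz : ‖z‖ ≠ 1) :
    ∃ c : ℂ, ∀ k,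
      uSol α t (weylMinus α (fun k => (hα k).le) t k₀) z k₀ k =
        c * uHatMinus α (fun k => (hα k).le) t z (k₀ - 1) k ∧
      vSol α t (weylMinus α (fun k => (hα k).le) t k₀) z k₀ k =
        c * vHatMinus α (fun k => (hα k).le) t z (k₀ - 1) k := by
  have hD := weylDen_mMinus_ne_zero (k₀ := k₀) (t := t) hα hz
  have hg := conj_gam_mul_gam t
  have hs := rho_sq (fun k => (hα k).le) k₀
  have hr := rho_ne_zero (hα k₀)
  set m := mMinus α (fun k => (hα k).le) t z (k₀ - 1) with hm
  set D := weylDen (α k₀ * gam t ^ 2) m with hDdef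
  set N := weylNum (α k₀ * gam t ^ 2) m with hNdef
  have hM : weylMinus α (fun k => (hα k).le) t k₀ z = N / D := rfl
  -- At `k₀` the solution `(u₋, v₋)` is, up to phases and a power of `z`, `(M - 1, M + 1)` or, for
  -- odd `k₀`, `(M + 1, M - 1)`. Thus `N ± D` must be proportional to the components of `û₋, v̂₋`
  -- carried across `Θ_{k₀}`.
  have hadd : N + D = 2 + 2 * (α k₀ * gam t ^ 2) + (2 - 2 * (α k₀ * gam t ^ 2)) * m := by
    rw [hNdef, hDdef, weylNum, weylDen]; ring
  have hsub : D - N = -2 - 2 * conj (α k₀) * conj (gam t) ^ 2 +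
      (2 - 2 * conj (α k₀) * conj (gam t) ^ 2) * m := by
    rw [hNdef, hDdef, weylNum, weylDen, map_mul, map_pow]; ring
  have hrel := blockRel_uHatMinus (t := t) (k₀ := k₀ - 1) hα hz0 k₀
  have hu1 : uHatMinus α (fun k => (hα k).le) t z (k₀ - 1) (k₀ - 1) =
    qMinus α t z (k₀ - 1) (k₀ - 1) + m * pMinus α t z (k₀ - 1) (k₀ - 1) := rfl
  have hv1 : vHatMinus α (fun k => (hα k).le) t z (k₀ - 1) (k₀ - 1) =
    sMinus α t z (k₀ - 1) (k₀ - 1) + m * rMinus α t z (k₀ - 1) (k₀ - 1) := rfl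
  have hND : D * (N / D) = N := mul_div_cancel₀ _ hD
  have hcD : D * (2 * rho α k₀ / D) = 2 * rho α k₀ := mul_div_cancel₀ _ hD
  -- The constant is forced: the difference of `M + 1` and `M - 1` is `2`, while the transferred
  -- components, freed of phases and powers of `z`, differ by `D / ρ`.
  refine ⟨2 * rho α k₀ / D, fun k => eq_of_blockRel (k₀ := k₀) hα hz0
    (blockRel_uSol hα hz0 _) (fun k => (blockRel_uHatMinus hα hz0 k).const_mul _) ?_ ?_ k⟩ <;>
  rcases Int.even_or_odd k₀ with hk | hk
  · obtain ⟨e1, e2, e3, e4⟩ := plus_self_of_even (α := α) (t := t) (z := z) hk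
    obtain ⟨f1, f2, f3, f4⟩ := minus_self_of_odd (α := α) (t := t) (z := z) (hk.sub_odd odd_one)
    obtain ⟨g1, g2⟩ := hrel.2 hk
    rw [hu1, hv1, f1, f2, f3, f4] at g1
    rw [hv1, f2, f4] at g2
    rw [uSol, hM, e1, e3]
    refine mul_left_cancel₀ hD ?_
    linear_combination gam t * hND - uHatMinus α (fun k => (hα k).le) t z (k₀ - 1) k₀ * hcD
      - gam t * hsub + 2 * rho α k₀ * g2 - 2 * gam t * (1 - m) * hs - 2 * conj (α k₀) * g1
      + 2 * conj (α k₀) * conj (gam t) * (1 + m) * hg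
  · obtain ⟨e1, e2, e3, e4⟩ := plus_self_of_odd (α := α) (t := t) (z := z) hk
    obtain ⟨f1, f2, f3, f4⟩ := minus_self_of_even (α := α) (t := t) (z := z) (hk.sub_odd odd_one)
    obtain ⟨g1, g2⟩ := hrel.1 hk
    rw [hu1, hv1, f1, f2, f3, f4] at g1
    rw [hu1, f1, f3] at g2
    rw [uSol, hM, e1, e3]
    refine mul_left_cancel₀ hD ?_
    linear_combination z * conj (gam t) * hND
      - uHatMinus α (fun k => (hα k).le) t z (k₀ - 1) k₀ * hcD
      + z * conj (gam t) * hadd - 2 * g1 + 2 * z * α k₀ * gam t * (1 - m) * hg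
  · obtain ⟨e1, e2, e3, e4⟩ := plus_self_of_even (α := α) (t := t) (z := z) hk
    obtain ⟨f1, f2, f3, f4⟩ := minus_self_of_odd (α := α) (t := t) (z := z) (hk.sub_odd odd_one)
    obtain ⟨g1, g2⟩ := hrel.2 hk
    rw [hu1, hv1, f1, f2, f3, f4] at g1
    rw [hv1, f2, f4] at g2
    rw [vSol, hM, e2, e4]
    refine mul_left_cancel₀ hD ?_
    linear_combination conj (gam t) * hND
      - vHatMinus α (fun k => (hα k).le) t z (k₀ - 1) k₀ * hcD
      + conj (gam t) * hadd - 2 * g1 + 2 * α k₀ * gam t * (1 - m) * hg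
  · obtain ⟨e1, e2, e3, e4⟩ := plus_self_of_odd (α := α) (t := t) (z := z) hk
    obtain ⟨f1, f2, f3, f4⟩ := minus_self_of_even (α := α) (t := t) (z := z) (hk.sub_odd odd_one)
    obtain ⟨g1, g2⟩ := hrel.1 hk
    rw [hu1, hv1, f1, f2, f3, f4] at g1
    rw [hu1, f1, f3] at g2
    rw [vSol, hM, e2, e4]
    refine mul_left_cancel₀ (mul_ne_zero hz0 hD) ?_
    linear_combination z * gam t * hND
      - z * vHatMinus α (fun k => (hα k).le) t z (k₀ - 1) k₀ * hcD
      - z * gam t * hsub + 2 * rho α k₀ * g2 - 2 * z * gam t * (1 - m) * hs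
      - 2 * conj (α k₀) * g1 + 2 * z * conj (α k₀) * conj (gam t) * (1 + m) * hg

theorem isWeylPlus_mPlus (hα : ∀ k, ‖α k‖ < 1) :
    IsWeylPlus α t k₀ (fun z => mPlus α (fun k => (hα k).le) t z k₀) :=
  ⟨isCaratheodory_mPlus _, fun _ hz0 hz => sqSummableOn_hatPlus hα hz0 hz⟩

theorem isWeylMinus_weylMinus (hα : ∀ k, ‖α k‖ < 1) :
    IsWeylMinus α t k₀ (weylMinus α (fun k => (hα k).le) t k₀) := by
  refine ⟨isAntiCaratheodory_weylMinus hα, fun z hz0 hz => ?_⟩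
  obtain ⟨c, hc⟩ := uSol_weylMinus_eq (t := t) (k₀ := k₀) hα hz0 hz
  obtain ⟨h1, h2⟩ := sqSummableOn_hatMinus (t := t) (k₀ := k₀ - 1) hα hz0 hz
  exact ⟨((h1.const_mul c).Iic k₀).congr fun k _ => (hc k).1.symm,
    ((h2.const_mul c).Iic k₀).congr fun k _ => (hc k).2.symm⟩

theorem IsWeylPlus.eq (hα : ∀ k, ‖α k‖ < 1) {M N : ℂ → ℂ} (hM : IsWeylPlus α t k₀ M)
    (hN : IsWeylPlus α t k₀ N) (z : ℂ) (hz : ‖z‖ ≠ 1) : M z = N z := by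
  refine eq_off_circle_of_eq_off_zero hM.1.1 hN.1.1 (fun z hz0 hz => ?_) z hz
  by_contra hne
  -- The difference of the two Weyl solutions is `(M - N) p₊`.
  refine not_sqSummableOn_pPlus (k₀ := k₀) (t := t) hα hz0 hz
    (((hM.2 z hz0 hz).1.linear_comb (hN.2 z hz0 hz).1 (1 / (M z - N z))
      (-1 / (M z - N z))).congr fun k _ => ?_)
  have := sub_ne_zero.2 hne
  rw [uSol, uSol]
  field_simp
  ring

theorem IsWeylMinus.eq (hα : ∀ k, ‖α k‖ < 1) {M N : ℂ → ℂ} (hM : IsWeylMinus α t k₀ M)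
    (hN : IsWeylMinus α t k₀ N) (z : ℂ) (hz : ‖z‖ ≠ 1) : M z = N z := by
  have han : ∀ {F : ℂ → ℂ}, IsWeylMinus α t k₀ F → AnalyticOnNhd ℂ F (Metric.ball 0 1) :=
    fun h x hx => by simpa using (h.1.1 x hx).fun_neg
  refine eq_off_circle_of_eq_off_zero (han hM) (han hN) (fun z hz0 hz => ?_) z hz
  by_contra hne
  obtain ⟨c, d, hcd⟩ := exists_pMinus_eq (k₀ := k₀) (t := t) hα hz0
  -- Two different values would make `q₊ + M p₊` and `q₊ + N p₊` a basis of all solutions. The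
  -- coefficients solve the 2×2 system expressing `p₋ = c p₊ + d q₊` in this basis.
  refine not_sqSummableOn_pMinus (k₀ := k₀) (t := t) hα hz0 hz
    (((hM.2 z hz0 hz).1.linear_comb (hN.2 z hz0 hz).1 ((c - d * N z) / (M z - N z))
      ((d * M z - c) / (M z - N z))).congr fun k _ => ?_)
  have := sub_ne_zero.2 hne
  rw [← hcd, uSol, uSol]
  field_simp
  ring

/-! ### The Green's function of the full-lattice operator -/

/-- Since `u±` share the same basis, only the mixed terms survive, with coefficient `M₊ - M₋`. -/
theorem wronskian_uSol (hα : ∀ k, ‖α k‖ < 1) (hz : z ≠ 0) (Mp Mm : ℂ → ℂ) (k' : ℤ) :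
    z ^ (-(k₀ % 2)) * wronskian (uSol α t Mm z k₀) (vSol α t Mm z k₀) (uSol α t Mp z k₀)
      (vSol α t Mp z k₀) k' = -2 * (Mp z - Mm z) := by
  have hc : wronskian (uSol α t Mm z k₀) (vSol α t Mm z k₀) (uSol α t Mp z k₀)
      (vSol α t Mp z k₀) k' = wronskian (uSol α t Mm z k₀) (vSol α t Mm z k₀) (uSol α t Mp z k₀)
      (vSol α t Mp z k₀) k₀ := by
    rcases le_total k₀ k' with h | h
    · exact wronskian_eq hz h (fun k _ _ => blockRel_uSol hα hz Mm k)
        (fun k _ _ => blockRel_uSol hα hz Mp k)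
    · exact (wronskian_eq hz h (fun k _ _ => blockRel_uSol hα hz Mm k)
        (fun k _ _ => blockRel_uSol hα hz Mp k)).symm
  have hg := conj_gam_mul_gam t
  rw [hc]
  rcases Int.even_or_odd k₀ with h | h
  · obtain ⟨e1, e2, e3, e4⟩ := plus_self_of_even (α := α) (t := t) (z := z) h
    rw [wronskian_of_even h, zpow_neg_emod_of_even h]
    simp only [uSol, vSol]
    rw [e1, e2, e3, e4]
    linear_combination (-2 * (Mp z - Mm z)) * hg
  · obtain ⟨e1, e2, e3, e4⟩ := plus_self_of_odd (α := α) (t := t) (z := z) h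
    rw [wronskian_of_odd h, zpow_neg_emod_of_odd h]
    simp only [uSol, vSol]
    rw [e1, e2, e3, e4]
    field_simp
    linear_combination (-2 * (Mp z - Mm z)) * hg

theorem entry_res_opU_eq_greenFull (hα : ∀ k, ‖α k‖ < 1) {Mp Mm : ℂ → ℂ}
    (hp : IsWeylPlus α t k₀ Mp) (hm : IsWeylMinus α t k₀ Mm) (hz0 : z ≠ 0) (hz : ‖z‖ ≠ 1)
    (hne : Mp z - Mm z ≠ 0) (k k' : ℤ) :
    entry (res (opU α (fun k => (hα k).le)) z) k k' = greenFull α t Mp Mm k₀ k k' z := by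
  have hw := wronskian_uSol (k₀ := k₀) (t := t) hα hz0 Mp Mm k'
  have hw0 : wronskian (uSol α t Mm z k₀) (vSol α t Mm z k₀) (uSol α t Mp z k₀)
      (vSol α t Mp z k₀) k' ≠ 0 := by
    intro h
    rw [h, mul_zero] at hw
    exact mul_ne_zero (by norm_num) hne hw.symm
  rw [entry_res_opU_eq (fun k => (hα k).le) hz0 hz (fun k _ => blockRel_uSol hα hz0 Mm k)
    (fun k _ => blockRel_uSol hα hz0 Mp k) (hm.2 z hz0 hz).1 (hp.2 z hz0 hz).1 hw0, greenFull]
  set G := greenCases k k' (uSol α t Mm z k₀ k * vSol α t Mp z k₀ k')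
    (uSol α t Mp z k₀ k * vSol α t Mm z k₀ k')
  have hzp := zpow_ne_zero (-(k₀ % 2)) hz0
  rw [div_mul_eq_mul_div, div_eq_div_iff (mul_ne_zero hz0 hw0)
    (mul_ne_zero (mul_ne_zero two_ne_zero hz0) hne)]
  linear_combination (z * G) * hw

theorem greenFull'_eq (hα : ∀ k, ‖α k‖ < 1) {Mp Mm : ℂ → ℂ}
    (hp : IsWeylPlus α t k₀ Mp) (hm : IsWeylMinus α t k₀ Mm) (hz0 : z ≠ 0) (hz : ‖z‖ ≠ 1)
    (k k' : ℤ) : greenFull' α t Mp Mm k₀ k k' z = greenFull α t Mp Mm k₀ k k' z := by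
  rw [greenFull', greenFull, uSol_conj hα hz0 (hp.1.conj_apply hz0 hz),
    uSol_conj hα hz0 (hm.1.conj_apply hz0 hz), div_eq_inv_mul, mul_greenCases, mul_greenCases]
  congr 1 <;> ring

end FullLattice

end CMV

end

/-! ### Assembly of the theorem -/

theorem lemma2p6 (α : ℤ → ℂ) (hα : ∀ k, ‖α k‖ < 1) (t : ℝ) (ht : t ∈ Set.Ico 0 (2 * Real.pi))
    (k₀ : ℤ) :
    -- the operators are unitary, and every `z` off the unit circle is in their resolvent sets
    ((CMV.opU α (fun k => (hα k).le)) ∈ unitary _ ∧ (CMV.opUPlus α (fun k => (hα k).le) t k₀) ∈ unitary _ ∧ (CMV.opUMinus α (fun k => (hα k).le) t k₀) ∈ unitary _) ∧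
    (∀ z : ℂ, ‖z‖ ≠ 1 → IsUnit ((CMV.opU α (fun k => (hα k).le)) - z • 1) ∧ IsUnit ((CMV.opUPlus α (fun k => (hα k).le) t k₀) - z • 1) ∧ IsUnit ((CMV.opUMinus α (fun k => (hα k).le) t k₀) - z • 1)) ∧
    -- square summability of `û±`, `v̂±`
    (∀ z : ℂ, z ≠ 0 → ‖z‖ ≠ 1 →
      CMV.SqSummableOn (Set.Ici k₀) (CMV.uHatPlus α (fun k => (hα k).le) t z k₀) ∧
      CMV.SqSummableOn (Set.Ici k₀) (CMV.vHatPlus α (fun k => (hα k).le) t z k₀) ∧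
      CMV.SqSummableOn (Set.Iic k₀) (CMV.uHatMinus α (fun k => (hα k).le) t z k₀) ∧
      CMV.SqSummableOn (Set.Iic k₀) (CMV.vHatMinus α (fun k => (hα k).le) t z k₀)) ∧
    -- the resolvent of `U₊`, and the extension to `z = 0`
    (∀ k k' : Set.Ici k₀,
      (∀ z : ℂ, z ≠ 0 → ‖z‖ ≠ 1 →
        CMV.entry (CMV.res (CMV.opUPlus α (fun k => (hα k).le) t k₀) z) k k' =
            CMV.greenPlus α (fun k => (hα k).le) t k₀ k k' z ∧
        CMV.entry (CMV.res (CMV.opUPlus α (fun k => (hα k).le) t k₀) z) k k' =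
            CMV.greenPlus' α (fun k => (hα k).le) t k₀ k k' z) ∧
      CMV.ExtendsToZero (CMV.greenPlus α (fun k => (hα k).le) t k₀ k k')
        (CMV.entry (CMV.res (CMV.opUPlus α (fun k => (hα k).le) t k₀) 0) k k') ∧
      CMV.ExtendsToZero (CMV.greenPlus' α (fun k => (hα k).le) t k₀ k k')
        (CMV.entry (CMV.res (CMV.opUPlus α (fun k => (hα k).le) t k₀) 0) k k')) ∧
    -- the resolvent of `U₋`, and the extension to `z = 0`
    (∀ k k' : Set.Iic k₀,
      (∀ z : ℂ, z ≠ 0 → ‖z‖ ≠ 1 →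
        CMV.entry (CMV.res (CMV.opUMinus α (fun k => (hα k).le) t k₀) z) k k' =
            CMV.greenMinus α (fun k => (hα k).le) t k₀ k k' z ∧
        CMV.entry (CMV.res (CMV.opUMinus α (fun k => (hα k).le) t k₀) z) k k' =
            CMV.greenMinus' α (fun k => (hα k).le) t k₀ k k' z) ∧
      CMV.ExtendsToZero (CMV.greenMinus α (fun k => (hα k).le) t k₀ k k')
        (CMV.entry (CMV.res (CMV.opUMinus α (fun k => (hα k).le) t k₀) 0) k k') ∧
      CMV.ExtendsToZero (CMV.greenMinus' α (fun k => (hα k).le) t k₀ k k')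
        (CMV.entry (CMV.res (CMV.opUMinus α (fun k => (hα k).le) t k₀) 0) k k')) ∧
    -- the Weyl-Titchmarsh functions `M±`, unique off the unit circle
    ∃ Mp Mm : ℂ → ℂ,
      CMV.IsWeylPlus α t k₀ Mp ∧ CMV.IsWeylMinus α t k₀ Mm ∧
      (∀ M : ℂ → ℂ, CMV.IsWeylPlus α t k₀ M → ∀ z : ℂ, ‖z‖ ≠ 1 → M z = Mp z) ∧
      (∀ M : ℂ → ℂ, CMV.IsWeylMinus α t k₀ M → ∀ z : ℂ, ‖z‖ ≠ 1 → M z = Mm z) ∧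
      (∀ z : ℂ, ‖z‖ ≠ 1 → Mp z - Mm z ≠ 0) ∧
      -- the resolvent of `U`, and the extension to `z = 0`
      ∀ k k' : ℤ,
        (∀ z : ℂ, z ≠ 0 → ‖z‖ ≠ 1 →
          CMV.entry (CMV.res (CMV.opU α (fun k => (hα k).le)) z) k k' =
            CMV.greenFull α t Mp Mm k₀ k k' z ∧
          CMV.entry (CMV.res (CMV.opU α (fun k => (hα k).le)) z) k k' =
            CMV.greenFull' α t Mp Mm k₀ k k' z) ∧
        CMV.ExtendsToZero (CMV.greenFull α t Mp Mm k₀ k k')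
        (CMV.entry (CMV.res (CMV.opU α (fun k => (hα k).le)) 0) k k') ∧
        CMV.ExtendsToZero (CMV.greenFull' α t Mp Mm k₀ k k')
        (CMV.entry (CMV.res (CMV.opU α (fun k => (hα k).le)) 0) k k') := by
  have hα' : ∀ k, ‖α k‖ ≤ 1 := fun k => (hα k).le
  have hU := CMV.opU_mem_unitary α hα'
  have hUp := CMV.opUPlus_mem_unitary α hα' t k₀
  have hUm := CMV.opUMinus_mem_unitary α hα' t k₀
  have hp := CMV.isWeylPlus_mPlus (t := t) (k₀ := k₀) hα
  have hm := CMV.isWeylMinus_weylMinus (t := t) (k₀ := k₀) hα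
  have hne : ∀ z : ℂ, ‖z‖ ≠ 1 → _ := fun z hz =>
    CMV.mPlus_sub_weylMinus_ne_zero (t := t) (k₀ := k₀) hα hz
  refine ⟨⟨hU, hUp, hUm⟩, fun z hz => ⟨CMV.isUnit_sub_of_mem_unitary hU hz,
    CMV.isUnit_sub_of_mem_unitary hUp hz, CMV.isUnit_sub_of_mem_unitary hUm hz⟩,
    fun z hz0 hz => ⟨(CMV.sqSummableOn_hatPlus hα hz0 hz).1,
      (CMV.sqSummableOn_hatPlus hα hz0 hz).2, CMV.sqSummableOn_hatMinus hα hz0 hz⟩,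
    -- The witnesses are read off from `hp` and `hm`: `m₊(·,k₀)` and the Möbius transform of
    -- `m₋(·,k₀ - 1)`.
    fun k k' => ?_, fun k k' => ?_, _, _, hp, hm, fun M hM => hM.eq hα hp,
    fun M hM => hM.eq hα hm, hne, fun k k' => ?_⟩
  · have h1 := fun z hz0 hz => CMV.entry_res_opUPlus_eq (t := t) (z := z) hα hz0 hz k k'
    have h2 := fun z hz0 hz =>
      (h1 z hz0 hz).trans (CMV.greenPlus'_eq (t := t) (k₀ := k₀) hα hz0 hz k k').symm
    exact ⟨fun z hz0 hz => ⟨h1 z hz0 hz, h2 z hz0 hz⟩,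
      CMV.extendsToZero_of_eq_entry_res hUp k k' h1, CMV.extendsToZero_of_eq_entry_res hUp k k' h2⟩
  · have h1 := fun z hz0 hz => CMV.entry_res_opUMinus_eq (t := t) (z := z) hα hz0 hz k k'
    have h2 := fun z hz0 hz =>
      (h1 z hz0 hz).trans (CMV.greenMinus'_eq (t := t) (k₀ := k₀) hα hz0 hz k k').symm
    exact ⟨fun z hz0 hz => ⟨h1 z hz0 hz, h2 z hz0 hz⟩,
      CMV.extendsToZero_of_eq_entry_res hUm k k' h1, CMV.extendsToZero_of_eq_entry_res hUm k k' h2⟩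
  · have h1 := fun z hz0 hz =>
      CMV.entry_res_opU_eq_greenFull (z := z) hα hp hm hz0 hz (hne z hz) k k'
    have h2 := fun z hz0 hz =>
      (h1 z hz0 hz).trans (CMV.greenFull'_eq hα hp hm hz0 hz k k').symm
    exact ⟨fun z hz0 hz => ⟨h1 z hz0 hz, h2 z hz0 hz⟩,
      CMV.extendsToZero_of_eq_entry_res hU k k' h1, CMV.extendsToZero_of_eq_entry_res hU k k' h2⟩
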